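/- Let $M$ be a smooth manifold (Hausdorff, second countable) of dimension $n\ge 2$ with a sub-Riemannian structure given by global smooth vector fields $X_1,\dots,X_m$ which are bracket-generating: at every $x\in M$ the values of the $X_i$ and of their iterated Lie brackets span $T_xM$. For $v\in\mathcal D_x=\mathrm{span}\{X_i(x)\}$ let $g_x(v,v)=\min\{\sum_i u_i^2 : \sum_i u_iX_i(x)=v\}$. A horizontal path on $[a,b]$ is an absolutely continuous $\gamma:[a,b]\to M$ with $\dot\gamma=\sum_i u_iX_i(\gamma)$ a.e. for some control $u\in L^2([a,b],\mathbb R^m)$; its length is $\ell(\gamma)=\int_a^b\sqrt{g(\dot\gamma,\dot\gamma)}\,dt$, its minimal control is the one with $|u(t)|^2=g(\dot\gamma(t),\dot\gamma(t))$ a.e., and $d_{SR}$ denotes the associated distance (infimum of lengths). Assume that $(M,d_{SR})$ is complete. Let $H:T^*M\to\mathbb R$, $H(\lambda)=\frac12\sum_i\langle\lambda,X_i\rangle^2$, with Hamiltonian vector field $\vec H$ defined by $\sigma(\cdot,\vec H)=dH$, where $\sigma=\sum_i dp_i\wedge dq_i$ in canonical coordinates, and let $\pi:T^*M\to M$ be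 the projection. A horizontal path $\gamma:[a,b]\to M$ is called the unique length minimizer between its endpoints up to reparametrization if $\ell(\gamma)\le\ell(c)$ for every horizontal $c:[a,b]\to M$ with $c(a)=\gamma(a)$, $c(b)=\gamma(b)$, and if equality implies $c=\gamma\circ\varphi$ for some continuous nondecreasing $\varphi$ from $[a,b]$ onto $[a,b]$. Then the flow $e^{t\vec H}$ exists for all times $t\in\mathbb R$, and the following hold. (1) Let $x\in M$ and let $\Lambda\subset T_x^*M$ be compact. For $\lambda\in\Lambda$ let $\gamma^\lambda(t)=\pi\circ e^{t\vec H}(\lambda)$. There is $\varepsilon>0$ such that, for all $\lambda\in\Lambda$, the restriction $\gamma^\lambda|_{[-\varepsilon,\varepsilon]}$ is (horizontal and) the unique length minimizer between its endpoints up to reparametrization. (2) Let $\gamma=\pi\circ\lambda:[0,1]\to M$ be a normal path with normal lift $\lambda(s)=e^{s\vec H}(\lambda_0)$, let $t\in(0,1)$, and let $A\subset T^*_{\gamma(t)}M$ be the set of abnormal Lagrange multipliers of $\gamma|_{[0,t]}$, i.e. the set of nonzero covectors $\eta$ with $\eta\circ D_uE=0$, where $E$ is the end-point map sending a control $v\in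 L^2([0,t],\mathbb R^m)$ to the value at time $t$ of the solution of $\dot\gamma_v=\sum_i v_iX_i(\gamma_v)$, $\gamma_v(0)=\gamma(0)$, and $u$ is the minimal control of $\gamma|_{[0,t]}$. For $\alpha\in A\cup\{0\}$ let $$\gamma_\alpha(s)=\pi\circ e^{(s-t)\vec H}(\lambda(t)+\alpha).$$ Then for every compact $A_0\subset A\cup\{0\}$ there is $\varepsilon>0$, with $[t-\varepsilon,t+\varepsilon]\subset[0,1]$, such that for all $\alpha\in A_0$ the restriction $\gamma_\alpha|_{[t-\varepsilon,t+\varepsilon]}$ is (horizontal and) the unique length minimizer between its endpoints up to reparametrization. In particular this holds when $\gamma$ is a strictly normal geodesic that branches at time $t$ and $\gamma_\alpha$ is the family of normal geodesics branching from it. -/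

import Mathlib

open Set MeasureTheory Filter Topology
open scoped Manifold ContDiff ENNReal

noncomputable section

namespace SubRiemannian

/-- The model space `ℝⁿ`. -/
abbrev Eucl (n : ℕ) : Type := EuclideanSpace ℝ (Fin n)

/-- The cotangent space `T*_x M`. -/
abbrev Cotangent (n : ℕ) {M : Type*} [TopologicalSpace M] [ChartedSpace (Eucl n) M]
    (x : M) : Type :=
  TangentSpace (𝓡 n) x →L[ℝ] ℝ

/-- Points of the cotangent bundle `T*M`: pairs of a base point and a covector at that point.
The bundle projection `π` is `ξ ↦ ξ.1`. -/
abbrev CotangentBundle (n : ℕ) (M : Type*) [TopologicalSpace M] [ChartedSpace (Eucl n) M] :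
    Type _ :=
  (x : M) × Cotangent n x

/-- The phase space `T*ℝⁿ = ℝⁿ × (ℝⁿ)*` of the coordinates `(q, p)`. -/
abbrev PhaseSpace (n : ℕ) : Type := Eucl n × (Eucl n →L[ℝ] ℝ)

/-- The canonical symplectic form `σ = ∑ dpᵢ ∧ dqᵢ` of `T*ℝⁿ`. -/
def symplecticForm {n : ℕ} (v w : PhaseSpace n) : ℝ := v.2 w.1 - w.2 v.1

section Coordinates

variable {n : ℕ} {M : Type*} [TopologicalSpace M] [ChartedSpace (Eucl n) M]

/-- The canonical coordinates `(q, p)` on `T*M` induced by the preferred chart `φ` at `c`: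
`q = φ(x)` and `p = ξ ∘ (d_x φ)⁻¹`, for a covector `ξ` at a point `x` of the domain of `φ`. -/
def cotangentCoord (c : M) (ξ : CotangentBundle n M) : PhaseSpace n :=
  (extChartAt (𝓡 n) c ξ.1,
    ξ.2 ∘L (mfderiv (𝓡 n) 𝓘(ℝ, Eucl n) (extChartAt (𝓡 n) c) ξ.1).inverse)

/-- The inverse of the canonical coordinates: `(q, p)` is sent to the covector `p ∘ d_x φ` at the
point `x = φ⁻¹(q)`. -/
def cotangentCoordSymm (c : M) (z : PhaseSpace n) : CotangentBundle n M :=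
  ⟨(extChartAt (𝓡 n) c).symm z.1,
    z.2 ∘L mfderiv (𝓡 n) 𝓘(ℝ, Eucl n) (extChartAt (𝓡 n) c) ((extChartAt (𝓡 n) c).symm z.1)⟩

/-- `ξ : ℝ → T*M` is an integral curve (defined for all times) of the Hamiltonian vector field
`h⃗` of the function `h` on `T*M`. In canonical coordinates, at every time the velocity `w` of the
curve satisfies `σ(·, w) = dh`. -/
def IsHamiltonianCurve (h : CotangentBundle n M → ℝ) (ξ : ℝ → CotangentBundle n M) : Prop :=
  Continuous (fun t => (ξ t).1) ∧
    ∀ (t : ℝ) (c : M), (ξ t).1 ∈ (chartAt (Eucl n) c).source →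
      ∃ w : PhaseSpace n, HasDerivAt (fun s => cotangentCoord c (ξ s)) w t ∧
        ∀ v : PhaseSpace n, symplecticForm v w =
          fderiv ℝ (fun z => h (cotangentCoordSymm c z)) (cotangentCoord c (ξ t)) v

/-- `Φ` is the flow `(t, ξ) ↦ e^{t h⃗}(ξ)` of the Hamiltonian vector field of `h`, defined for all
times. -/
def IsHamiltonianFlow (h : CotangentBundle n M → ℝ)
    (Φ : ℝ → CotangentBundle n M → CotangentBundle n M) : Prop :=
  ∀ ξ, Φ 0 ξ = ξ ∧ IsHamiltonianCurve h (fun t => Φ t ξ)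

/-- `γ` is an absolutely continuous curve on `[a, b]`: it is continuous and, in coordinates, every
piece of it contained in a chart is absolutely continuous. -/
def IsAbsolutelyContinuous (γ : ℝ → M) (a b : ℝ) : Prop :=
  ContinuousOn γ (Icc a b) ∧
    ∀ (s t : ℝ) (c : M), a ≤ s → s ≤ t → t ≤ b → MapsTo γ (Icc s t) (chartAt (Eucl n) c).source →
      AbsolutelyContinuousOnInterval (fun r => extChartAt (𝓡 n) c (γ r)) s t

/-- The velocity `γ̇(t)`. -/
def velocity (γ : ℝ → M) (t : ℝ) : TangentSpace (𝓡 n) (γ t) :=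
  mfderiv 𝓘(ℝ, ℝ) (𝓡 n) γ t (1 : ℝ)

/-- `c` is a reparametrization of `γ`, as curves on `[a, b]` with the same endpoints: `c = γ ∘ φ`
for a continuous nondecreasing `φ` from `[a, b]` onto itself. -/
def IsReparametrization (c γ : ℝ → M) (a b : ℝ) : Prop :=
  ∃ φ : ℝ → ℝ, ContinuousOn φ (Icc a b) ∧ MonotoneOn φ (Icc a b) ∧ φ a = a ∧ φ b = b ∧
    ∀ t ∈ Icc a b, c t = γ (φ t)

/-- The iterated Lie brackets of the vector fields `X₁, …, Xₘ`. -/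
inductive IteratedBracket {m : ℕ} (X : Fin m → (x : M) → TangentSpace (𝓡 n) x) :
    ((x : M) → TangentSpace (𝓡 n) x) → Prop
  | frame (i : Fin m) : IteratedBracket X (X i)
  | bracket (V W : (x : M) → TangentSpace (𝓡 n) x) :
      IteratedBracket X V → IteratedBracket X W →
        IteratedBracket X (VectorField.mlieBracket (𝓡 n) V W)

end Coordinates

/-- A (bracket-generating) sub-Riemannian structure on the `n`-dimensional manifold `M`, given by a
generating frame of `m` global smooth vector fields. The distribution may be rank-varying. -/
structure SubRiemannianStructure (n m : ℕ) (M : Type*) [TopologicalSpace M]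
    [ChartedSpace (Eucl n) M] [IsManifold (𝓡 n) ∞ M] where
  /-- The vector fields `X₁, …, Xₘ`. -/
  frame : Fin m → (x : M) → TangentSpace (𝓡 n) x
  smooth : ∀ i, ContMDiff (𝓡 n) (𝓡 n).tangent ∞
    (fun x => (⟨x, frame i x⟩ : TangentBundle (𝓡 n) M))
  bracketGenerating : ∀ x : M,
    Submodule.span ℝ {v : TangentSpace (𝓡 n) x | ∃ V, IteratedBracket frame V ∧ V x = v} = ⊤

namespace SubRiemannianStructure

variable {n m : ℕ} {M : Type*} [TopologicalSpace M] [ChartedSpace (Eucl n) M]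
  [IsManifold (𝓡 n) ∞ M] (S : SubRiemannianStructure n m M)

/-- The vector `∑ uᵢ Xᵢ(x)`. -/
def comb (x : M) (u : Eucl m) : TangentSpace (𝓡 n) x := ∑ i, u i • S.frame i x

/-- The squared norm `g_x(v, v) = min {∑ uᵢ² | ∑ uᵢ Xᵢ(x) = v}` of a horizontal vector `v`. -/
def sqNorm (x : M) (v : TangentSpace (𝓡 n) x) : ℝ :=
  sInf {r : ℝ | ∃ u : Eucl m, S.comb x u = v ∧ r = ∑ i, u i ^ 2}

/-- `γ` is a horizontal curve on `[a, b]` with control `u ∈ L²([a, b], ℝᵐ)`: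
it is absolutely continuous and `γ̇(t) = ∑ uᵢ(t) Xᵢ(γ(t))` for almost every `t`. -/
def IsControlledBy (γ : ℝ → M) (a b : ℝ) (u : ℝ → Eucl m) : Prop :=
  IsAbsolutelyContinuous (n := n) γ a b ∧
    MemLp u 2 (volume.restrict (Icc a b)) ∧
    ∀ᵐ t ∂(volume.restrict (Icc a b)),
      MDifferentiableAt 𝓘(ℝ, ℝ) (𝓡 n) γ t ∧ velocity γ t = S.comb (γ t) (u t)

/-- `γ` is a horizontal curve on `[a, b]`. -/
def IsHorizontal (γ : ℝ → M) (a b : ℝ) : Prop := ∃ u, S.IsControlledBy γ a b u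

/-- `u` is the minimal control of the horizontal curve `γ` on `[a, b]`. -/
def IsMinimalControl (γ : ℝ → M) (a b : ℝ) (u : ℝ → Eucl m) : Prop :=
  S.IsControlledBy γ a b u ∧
    ∀ᵐ t ∂(volume.restrict (Icc a b)), S.sqNorm (γ t) (velocity γ t) = ∑ i, u t i ^ 2

/-- The length `ℓ(γ) = ∫ₐᵇ √(g(γ̇, γ̇)) dt` of a horizontal curve on `[a, b]`. -/
def length (γ : ℝ → M) (a b : ℝ) : ℝ≥0∞ :=
  ∫⁻ t in Icc a b, ENNReal.ofReal (Real.sqrt (S.sqNorm (γ t) (velocity γ t)))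

/-- The sub-Riemannian distance. -/
def distSR (x y : M) : ℝ≥0∞ :=
  ⨅ (γ : ℝ → M) (_ : S.IsHorizontal γ 0 1 ∧ γ 0 = x ∧ γ 1 = y), S.length γ 0 1

/-- `(M, d_SR)` is complete: every Cauchy sequence converges. -/
def IsCompleteSR : Prop :=
  ∀ x : ℕ → M,
    (∀ ε : ℝ≥0∞, 0 < ε → ∃ N, ∀ i ≥ N, ∀ j ≥ N, S.distSR (x i) (x j) < ε) →
      ∃ y, Tendsto (fun i => S.distSR (x i) y) atTop (𝓝 0)

/-- The Hamiltonian `H(ξ) = ½ ∑ ⟨ξ, Xᵢ⟩²`. -/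
def hamiltonian (ξ : CotangentBundle n M) : ℝ := (1 / 2) * ∑ i, (ξ.2 (S.frame i ξ.1)) ^ 2

/-- `γ` restricted to `[a, b]` is the unique length-minimizing path between its extremities, up to
reparametrization: it is horizontal, no horizontal path with the same extremities is shorter, and
those of the same length are reparametrizations of it. -/
def IsUniqueLengthMinimizer (γ : ℝ → M) (a b : ℝ) : Prop :=
  S.IsHorizontal γ a b ∧
    ∀ c : ℝ → M, S.IsHorizontal c a b → c a = γ a → c b = γ b →
      S.length γ a b ≤ S.length c a b ∧
        (S.length c a b = S.length γ a b → IsReparametrization c γ a b)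

/-- The controls `u ∈ L²([0, T], ℝᵐ)`. -/
abbrev Control (m : ℕ) (T : ℝ) : Type := Lp (Eucl m) 2 (volume.restrict (Icc (0 : ℝ) T))

open Classical in
/-- The end-point map `E_x : u ↦ γ_u(T)`, where `γ_u` solves `γ̇ = ∑ uᵢ Xᵢ(γ)`, `γ(0) = x`, on
`[0, T]`. It is only meaningful on the open set of the controls for which a solution exists (other
controls are sent to `x`). -/
def endPoint (x : M) (T : ℝ) (u : Control m T) : M :=
  if h : ∃ γ : ℝ → M, S.IsControlledBy γ 0 T u ∧ γ 0 = x then h.choose T else x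

/-- The set `A ⊆ T*_{γ(T)} M` of abnormal Lagrange multipliers of the horizontal curve `γ` on
`[0, T]`: the nonzero covectors `η` at the end-point with `η ∘ D_u E_x = 0`, where `x = γ(0)` and
`u` is the minimal control of `γ` on `[0, T]` (so that `E_x(u) = γ(T)`). -/
def abnormalMultipliers (γ : ℝ → M) (T : ℝ) : Set (Cotangent n (γ T)) :=
  {η | η ≠ 0 ∧ ∃ u : Control m T, S.IsMinimalControl γ 0 T u ∧
    ∃ η' : Cotangent n (S.endPoint (γ 0) T u),
      (⟨S.endPoint (γ 0) T u, η'⟩ : CotangentBundle n M) = ⟨γ T, η⟩ ∧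
        η' ∘L mfderiv 𝓘(ℝ, Control m T) (𝓡 n) (S.endPoint (γ 0) T) u = 0}

end SubRiemannianStructure

end SubRiemannian

end

open SubRiemannian

/-! Minimality is proved by calibration in a chart. Let γ be the projection of a Hamiltonian curve
of energy h, p its momentum, y = x − γ(τ), and consider the function h τ + p(τ)(y) − K (τ −
t₀)|y|²/2 of (τ, x). When the left side ∂_τ + H(x, ∂_x) of the Hamilton-Jacobi equation is expanded
around γ(τ), the terms of order 0 and 1 in y cancel by Hamilton's equations and the homogeneity of
H. The τ-derivative of the last term contributes −K|y|²/2, which beats the Taylor remainder of H, so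
the result is at most −|y|² (`residual_le`). The bound needs K|τ − t₀| ≤ 1, so that ∂_x stays in a
fixed compact set.

Let c be a competitor of length L with the same endpoints, and σ its normalized arc length, so that
c has speed v σ' with v = L/(2ε). By Cauchy-Schwarz, η(c') ≤ √(2H(c, η)) v σ' ≤ σ' (H(c, η) + v²/2).
Hence the calibrating function minus v² τ/2, evaluated at τ = σ(s), x = c(s), has derivative at most
−σ'|y|². Its total increment is (h − v²/2) 2ε, because y vanishes at both ends; so L ≥ √(2h) 2ε,
which bounds the length of γ from above. If the lengths agree, then σ'|y|² = 0 almost everywhere,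
|y|² is constant, and c = γ ∘ σ (`calibration`). A competitor that leaves the chart is too long to
matter (`mem_chart_of_length_le`). All constants depend on the chart and on a bound for the initial
covectors, so ε is uniform on compact sets (`exists_isUniqueLengthMinimizer`). Statement (2) is this
result for the covectors λ(t) + A₀.

For completeness of the flow: energy is conserved, so projections of Hamiltonian curves are
Lipschitz for the sub-Riemannian distance and converge at a finite end of their domain. In a chart
the momentum then satisfies a linear differential inequality and converges too. The curve can be
prolonged by a local solution, and Zorn's lemma gives a curve on all of ℝ (`exists_forall_isHamAt`).
-/

namespace SubRiemannian

/-! ### Absolutely continuous functions, Taylor and Gronwall type bounds, and the calibration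
argument in a vector space. -/

section Analysis

open AbsolutelyContinuousOnInterval in
theorem _root_.LipschitzOnWith.comp_absolutelyContinuousOnInterval {X Y : Type*}
    [PseudoMetricSpace X] [PseudoMetricSpace Y] {f : X → Y} {g : ℝ → X} {a b : ℝ} {K : NNReal}
    {s : Set X} (hf : LipschitzOnWith K f s) (hg : AbsolutelyContinuousOnInterval g a b)
    (hs : MapsTo g (uIcc a b) s) : AbsolutelyContinuousOnInterval (fun t => f (g t)) a b := by
  unfold AbsolutelyContinuousOnInterval at hg ⊢
  have h0 : Tendsto (fun E : ℕ × (ℕ → ℝ × ℝ) =>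
      K * ∑ i ∈ Finset.range E.1, dist (g (E.2 i).1) (g (E.2 i).2))
      (totalLengthFilter ⊓ 𝓟 (disjWithin a b)) (𝓝 0) := by
    simpa using hg.const_mul (K : ℝ)
  refine squeeze_zero' (Eventually.of_forall fun E => Finset.sum_nonneg fun i _ => dist_nonneg)
    ?_ h0
  refine eventually_inf_principal.2 (Eventually.of_forall fun E hE => ?_)
  rw [Finset.mul_sum]
  exact Finset.sum_le_sum fun i hi =>
    hf.dist_le_mul _ (hs (hE.1 i hi).1) _ (hs (hE.1 i hi).2)

-- Serves both quadratic terms of the calibrating function: the pairing p(σ)(c − γ ∘ σ) and the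
-- squared norm of c − γ ∘ σ.
open AbsolutelyContinuousOnInterval in
theorem _root_.AbsolutelyContinuousOnInterval.bilinear {E F G : Type*} [NormedAddCommGroup E]
    [NormedSpace ℝ E] [NormedAddCommGroup F] [NormedSpace ℝ F] [NormedAddCommGroup G]
    [NormedSpace ℝ G] (B : E →L[ℝ] F →L[ℝ] G) {f : ℝ → E} {g : ℝ → F} {a b : ℝ}
    (hf : AbsolutelyContinuousOnInterval f a b) (hg : AbsolutelyContinuousOnInterval g a b) :
    AbsolutelyContinuousOnInterval (fun t => B (f t) (g t)) a b := by
  obtain ⟨C, hC⟩ := hf.exists_bound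
  obtain ⟨D, hD⟩ := hg.exists_bound
  unfold AbsolutelyContinuousOnInterval at hf hg ⊢
  have h0 : Tendsto (fun E : ℕ × (ℕ → ℝ × ℝ) =>
      (‖B‖ * D) * ∑ i ∈ Finset.range E.1, dist (f (E.2 i).1) (f (E.2 i).2) +
      (‖B‖ * C) * ∑ i ∈ Finset.range E.1, dist (g (E.2 i).1) (g (E.2 i).2))
      (totalLengthFilter ⊓ 𝓟 (disjWithin a b)) (𝓝 0) := by
    simpa using (hf.const_mul (‖B‖ * D)).add (hg.const_mul (‖B‖ * C))
  refine squeeze_zero' (Eventually.of_forall fun E => Finset.sum_nonneg fun i _ => dist_nonneg)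
    ?_ h0
  refine eventually_inf_principal.2 (Eventually.of_forall fun E hE => ?_)
  rw [Finset.mul_sum, Finset.mul_sum, ← Finset.sum_add_distrib]
  refine Finset.sum_le_sum fun i hi => ?_
  obtain ⟨h1, h2⟩ := hE.1 i hi
  have key : B (f (E.2 i).1) (g (E.2 i).1) - B (f (E.2 i).2) (g (E.2 i).2) =
      B (f (E.2 i).1 - f (E.2 i).2) (g (E.2 i).1) + B (f (E.2 i).2) (g (E.2 i).1 - g (E.2 i).2) := by
    simp
  rw [dist_eq_norm, dist_eq_norm, dist_eq_norm, key]
  refine (norm_add_le _ _).trans (add_le_add ?_ ?_)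
  · refine (B.le_opNorm₂ _ _).trans ?_
    calc _ ≤ ‖B‖ * ‖f (E.2 i).1 - f (E.2 i).2‖ * D := by gcongr; exact hD _ h1
      _ = _ := by ring
  · refine (B.le_opNorm₂ _ _).trans ?_
    calc _ ≤ ‖B‖ * C * ‖g (E.2 i).1 - g (E.2 i).2‖ := by gcongr; exact hC _ h2

/-- Quadratic bound for the first order Taylor remainder of a `C²` function on a compact convex
set. -/
theorem exists_taylor_remainder_le {E : Type*} [NormedAddCommGroup E] [NormedSpace ℝ E]
    {f : E → ℝ} {U K : Set E} (hU : IsOpen U) (hf : ContDiffOn ℝ 2 f U) (hK : IsCompact K)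
    (hconv : Convex ℝ K) (hKU : K ⊆ U) :
    ∃ C : ℝ, 0 ≤ C ∧ ∀ z ∈ K, ∀ w ∈ K, |f w - f z - fderiv ℝ f z (w - z)| ≤ C * ‖w - z‖ ^ 2 := by
  have h1 : ContDiffOn ℝ 1 (fderiv ℝ f) U := hf.fderiv_of_isOpen hU (by norm_num)
  obtain ⟨C, hC⟩ := (h1.mono hKU).exists_lipschitzOnWith (by decide) hconv hK
  refine ⟨C, C.2, fun z hz w hw => ?_⟩
  -- The mean value inequality is applied to f minus its differential at z; on the segment its
  -- derivative is at most C ‖w − z‖, since `fderiv ℝ f` is C-Lipschitz on K.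
  have hd : ∀ x ∈ segment ℝ z w,
      HasFDerivWithinAt (fun x => f x - fderiv ℝ f z x) (fderiv ℝ f x - fderiv ℝ f z)
        (segment ℝ z w) x := by
    intro x hx
    have hxU : x ∈ U := hKU (hconv.segment_subset hz hw hx)
    have := ((hf.contDiffAt (hU.mem_nhds hxU)).differentiableAt (by norm_num)).hasFDerivAt
    exact (this.sub (fderiv ℝ f z).hasFDerivAt).hasFDerivWithinAt
  have := (convex_segment z w).norm_image_sub_le_of_norm_hasFDerivWithin_le (C := C * ‖w - z‖) hd
    (fun x hx => ?_) (left_mem_segment ℝ z w) (right_mem_segment ℝ z w)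
  · rw [Real.norm_eq_abs] at this
    calc _ = |f w - fderiv ℝ f z w - (f z - fderiv ℝ f z z)| := by rw [map_sub]; ring_nf
      _ ≤ _ := this
      _ = _ := by ring
  · refine (hC.norm_sub_le (hconv.segment_subset hz hw hx) hz).trans ?_
    gcongr
    exact norm_sub_le_of_mem_segment hx

/-- A solution of a linear differential inequality is controlled by its value at any time of a
short interval. -/
theorem norm_le_two_mul_of_norm_deriv_le {F : Type*} [NormedAddCommGroup F] [NormedSpace ℝ F]
    {p p' : ℝ → F} {a b L : ℝ} (hp : ∀ t ∈ Icc a b, HasDerivWithinAt p (p' t) (Icc a b) t)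
    (hL : ∀ t ∈ Icc a b, ‖p' t‖ ≤ L * ‖p t‖) (hL0 : 0 ≤ L) (hab : (b - a) * L ≤ 1 / 2)
    {s t : ℝ} (hs : s ∈ Icc a b) (ht : t ∈ Icc a b) : ‖p t‖ ≤ 2 * ‖p s‖ := by
  have hcont : ContinuousOn p (Icc a b) := fun t ht => (hp t ht).continuousWithinAt
  -- At a maximum r of ‖p‖ the increment from s is at most ‖p r‖ / 2 and is absorbed; this replaces
  -- Gronwall's lemma.
  obtain ⟨r, hr, hmax⟩ := isCompact_Icc.exists_isMaxOn ⟨s, hs⟩ hcont.norm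
  have hmax' : ∀ t ∈ Icc a b, ‖p t‖ ≤ ‖p r‖ := hmax
  have := (convex_Icc a b).norm_image_sub_le_of_norm_hasDerivWithin_le (C := L * ‖p r‖) hp
    (fun t ht => (hL t ht).trans (by gcongr; exact hmax' t ht)) hs hr
  have h2 : ‖r - s‖ ≤ b - a := by
    rw [Real.norm_eq_abs, abs_le]; constructor <;> linarith [hs.1, hs.2, hr.1, hr.2]
  have h3 : ‖p r - p s‖ ≤ 1 / 2 * ‖p r‖ := by
    calc _ ≤ L * ‖p r‖ * ‖r - s‖ := this
      _ ≤ L * ‖p r‖ * (b - a) := by gcongr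
      _ = ((b - a) * L) * ‖p r‖ := by ring
      _ ≤ _ := by gcongr
  have h4 : ‖p r‖ ≤ ‖p r - p s‖ + ‖p s‖ := norm_le_norm_sub_add _ _
  linarith [hmax' t ht]

/-- The derivative of the calibrating function along a curve `c` and a time change `σ`. -/
theorem exists_hasDerivAt_calibration_le {E : Type*} [NormedAddCommGroup E] [InnerProductSpace ℝ E]
    {h v K t₀ s σ₁ A : ℝ} {γ c : ℝ → E} {γ' c' : E} {p : ℝ → (E →L[ℝ] ℝ)} {p' : E →L[ℝ] ℝ}
    {σ : ℝ → ℝ} (hγ : HasDerivAt γ γ' (σ s)) (hp : HasDerivAt p p' (σ s))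
    (hc : HasDerivAt c c' s) (hσ : HasDerivAt σ σ₁ s) (hσ0 : 0 ≤ σ₁) (hA : 0 ≤ A)
    (hspeed : (p (σ s) - (K * (σ s - t₀)) • innerSL ℝ (c s - γ (σ s))) c' ≤ √(2 * A) * (v * σ₁))
    (hres : h + p' (c s - γ (σ s)) -
        (p (σ s) - (K * (σ s - t₀)) • innerSL ℝ (c s - γ (σ s))) γ' -
        K / 2 * ‖c s - γ (σ s)‖ ^ 2 + A ≤ -‖c s - γ (σ s)‖ ^ 2) :
    ∃ F', HasDerivAt (fun s => (h - v ^ 2 / 2) * σ s + p (σ s) (c s - γ (σ s)) -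
        (K / 2 * (σ s - t₀)) * innerSL ℝ (c s - γ (σ s)) (c s - γ (σ s))) F' s ∧
      F' ≤ -(σ₁ * ‖c s - γ (σ s)‖ ^ 2) := by
  have hyd : HasDerivAt (fun s => c s - γ (σ s)) (c' - σ₁ • γ') s := hc.sub (hγ.scomp s hσ)
  have hpd : HasDerivAt (fun s => p (σ s)) (σ₁ • p') s := hp.scomp s hσ
  refine ⟨_, ((hσ.const_mul (h - v ^ 2 / 2)).add (hpd.clm_apply hyd)).sub
    (((hσ.sub_const t₀).const_mul (K / 2)).mul (hyd.inner ℝ hyd)), ?_⟩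
  generalize c s - γ (σ s) = y at *
  have hyn : inner ℝ y y = ‖y‖ ^ 2 := real_inner_self_eq_norm_sq _
  -- Young's inequality: it turns the speed bound into the term H + v²/2, of which v²/2 is
  -- compensated by the coefficient h − v²/2.
  have e3 : √(2 * A) * v ≤ A + v ^ 2 / 2 := by
    have := Real.sq_sqrt (show 0 ≤ 2 * A by linarith)
    nlinarith [sq_nonneg (√(2 * A) - v)]
  have e4 := hspeed.trans (show √(2 * A) * (v * σ₁) ≤ σ₁ * (A + v ^ 2 / 2) by
    calc _ = σ₁ * (√(2 * A) * v) := by ring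
      _ ≤ _ := by gcongr)
  have e5 := mul_le_mul_of_nonneg_left hres hσ0
  have e6 : inner ℝ (c' - σ₁ • γ') y = inner ℝ y (c' - σ₁ • γ') := real_inner_comm _ _
  simp only [sub_apply, smul_apply, innerSL_apply_apply,
    smul_eq_mul] at e4 e5
  simp only [e6, hyn, innerSL_apply_apply, smul_apply, map_sub, map_smul,
    smul_eq_mul, inner_sub_right, inner_smul_right]
  linarith

/-- A function with `F' ≤ -σ' |y|²` decreases, and `y` is constant if `F` is and `y' = 0` wherever
`σ' = 0`. -/
theorem nonpos_and_eq_zero_of_deriv_le {E : Type*} [NormedAddCommGroup E] [InnerProductSpace ℝ E]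
    {a b Δ : ℝ} (hab : a ≤ b) {F σ' : ℝ → ℝ} {y y' : ℝ → E}
    (hF : AbsolutelyContinuousOnInterval F a b) (hy : AbsolutelyContinuousOnInterval y a b)
    (hFΔ : F b - F a = Δ) (hya : y a = 0) (hσ0 : ∀ᵐ s, s ∈ Icc a b → 0 ≤ σ' s)
    (hF' : ∀ᵐ s, s ∈ Icc a b → deriv F s ≤ -(σ' s * ‖y s‖ ^ 2))
    (hy' : ∀ᵐ s, s ∈ Icc a b → HasDerivAt y (y' s) s)
    (h0 : ∀ᵐ s, s ∈ Icc a b → σ' s = 0 → y' s = 0) :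
    Δ ≤ 0 ∧ (0 ≤ Δ → ∀ s ∈ Icc a b, y s = 0) := by
  have hIu : uIcc a b = Icc a b := uIcc_of_le hab
  have hint := hF.integral_deriv_eq_sub
  have hFi := hF.intervalIntegrable_deriv
  rw [hFΔ, intervalIntegral.integral_of_le hab] at hint
  rw [intervalIntegrable_iff_integrableOn_Ioc_of_le hab] at hFi
  have hF0' : ∀ᵐ s ∂(volume.restrict (Ioc a b)), 0 ≤ -deriv F s := by
    rw [ae_restrict_iff' measurableSet_Ioc]
    filter_upwards [hF', hσ0] with s h1 h2 hs
    have hs' := Ioc_subset_Icc_self hs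
    have := mul_nonneg (h2 hs') (sq_nonneg ‖y s‖)
    linarith [h1 hs']
  have hneg : 0 ≤ ∫ s in Ioc a b, -deriv F s := integral_nonneg_of_ae hF0'
  rw [integral_neg, hint] at hneg
  refine ⟨by linarith, fun hΔ s hs => ?_⟩
  have hz : ∫ s in Ioc a b, -deriv F s = 0 := by
    rw [integral_neg, hint]; linarith
  rw [integral_eq_zero_iff_of_nonneg_ae hF0' hFi.neg, Filter.EventuallyEq,
    ae_restrict_iff' measurableSet_Ioc] at hz
  have hne : ∀ᵐ s : ℝ, s ≠ a := by simp [ae_iff, measure_singleton]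
  -- The derivative of |y|² is twice the product of y and y', and almost everywhere either y = 0, or
  -- σ' = 0 and then y' = 0.
  have hyy0 : ∀ᵐ s, s ∈ uIcc a b → HasDerivAt (fun s => innerSL ℝ (y s) (y s)) 0 s := by
    filter_upwards [hz, hne, hF', hσ0, hy', h0] with s h1 h2 h3 h4 h5 h6 hs
    rw [hIu] at hs
    have h1' : deriv F s = 0 := by simpa using h1 ⟨lt_of_le_of_ne hs.1 h2.symm, hs.2⟩
    have h7 := h3 hs
    rw [h1'] at h7
    have h8 : σ' s * ‖y s‖ ^ 2 = 0 :=
      le_antisymm (by linarith) (mul_nonneg (h4 hs) (sq_nonneg _))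
    have hd := (h5 hs).inner ℝ (h5 hs)
    rcases mul_eq_zero.1 h8 with h | h
    · rw [h6 hs h, inner_zero_left, inner_zero_right, add_zero] at hd
      exact hd
    · have : y s = 0 := by simpa using h
      rw [this, inner_zero_left, inner_zero_right, add_zero] at hd
      exact hd
  have hyyAC : AbsolutelyContinuousOnInterval (fun s => innerSL ℝ (y s) (y s)) a b :=
    hy.bilinear (innerSL ℝ) hy
  obtain ⟨C, hC⟩ := hyyAC.const_of_ae_hasDerivAt_zero hyy0
  have h1 := hC s (hIu ▸ hs)
  have h2 := hC a left_mem_uIcc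
  rw [hya, map_zero] at h2
  rw [← h2] at h1
  simpa using h1

/-- Calibration: a curve `γ` with momentum `p` is compared with a curve `c` by means of the function
`h τ + p(τ) (x - γ τ) - K (τ - t₀) |x - γ τ|² / 2` evaluated at `x = c s`, `τ = σ s`. -/
theorem calibration {E : Type*} [NormedAddCommGroup E] [InnerProductSpace ℝ E]
    {H : E → (E →L[ℝ] ℝ) → ℝ} (hH : ∀ x η, 0 ≤ H x η) {t₀ ε K h v : ℝ} (hε : 0 < ε)
    {γ γ' : ℝ → E} {p p' : ℝ → (E →L[ℝ] ℝ)} {I : Set ℝ} (hI : I = Icc (t₀ - ε) (t₀ + ε))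
    (hγ : ∀ s ∈ I, HasDerivAt γ (γ' s) s) (hp : ∀ s ∈ I, HasDerivAt p (p' s) s)
    {Lγ Lp : NNReal} (hLγ : LipschitzOnWith Lγ γ I) (hLp : LipschitzOnWith Lp p I)
    {c c' : ℝ → E} {σ σ' : ℝ → ℝ} (hc : AbsolutelyContinuousOnInterval c (t₀ - ε) (t₀ + ε))
    (hσ : AbsolutelyContinuousOnInterval σ (t₀ - ε) (t₀ + ε)) (hσI : MapsTo σ I I)
    (hσa : σ (t₀ - ε) = t₀ - ε) (hσb : σ (t₀ + ε) = t₀ + ε)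
    (hc' : ∀ᵐ s, s ∈ I → HasDerivAt c (c' s) s) (hσ' : ∀ᵐ s, s ∈ I → HasDerivAt σ (σ' s) s)
    (hσ0 : ∀ᵐ s, s ∈ I → 0 ≤ σ' s)
    (hspeed : ∀ᵐ s, s ∈ I → ∀ η : E →L[ℝ] ℝ, η (c' s) ≤ √(2 * H (c s) η) * (v * σ' s))
    (hres : ∀ s ∈ I, ∀ τ ∈ I, ∀ η : E →L[ℝ] ℝ,
      η = p τ - (K * (τ - t₀)) • innerSL ℝ (c s - γ τ) →
      h + p' τ (c s - γ τ) - η (γ' τ) - K / 2 * ‖c s - γ τ‖ ^ 2 + H (c s) η ≤ -‖c s - γ τ‖ ^ 2)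
    (hca : c (t₀ - ε) = γ (t₀ - ε)) (hcb : c (t₀ + ε) = γ (t₀ + ε)) :
    h ≤ v ^ 2 / 2 ∧ (v ^ 2 / 2 ≤ h → ∀ s ∈ I, c s = γ (σ s)) := by
  have hab : t₀ - ε ≤ t₀ + ε := by linarith
  have hIu : uIcc (t₀ - ε) (t₀ + ε) = I := by rw [uIcc_of_le hab, hI]
  have hyAC : AbsolutelyContinuousOnInterval (fun s => c s - γ (σ s)) (t₀ - ε) (t₀ + ε) :=
    hc.fun_sub (hLγ.comp_absolutelyContinuousOnInterval hσ (by rwa [hIu]))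
  have hpAC := hLp.comp_absolutelyContinuousOnInterval hσ (by rwa [hIu])
  have hyyAC := hyAC.bilinear (innerSL ℝ) hyAC
  have hpyAC := hpAC.bilinear (ContinuousLinearMap.id ℝ (E →L[ℝ] ℝ)) hyAC
  have hcst : AbsolutelyContinuousOnInterval (fun _ => t₀) (t₀ - ε) (t₀ + ε) :=
    (LipschitzWith.const t₀).lipschitzOnWith.absolutelyContinuousOnInterval (K := 0)
  have hFAC := ((hσ.const_mul (h - v ^ 2 / 2)).fun_add hpyAC).fun_sub
      (((hσ.fun_sub hcst).const_mul (K / 2)).fun_mul hyyAC)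
  have key := nonpos_and_eq_zero_of_deriv_le hab hFAC hyAC (Δ := (h - v ^ 2 / 2) * (2 * ε))
    (σ' := σ') (y' := fun s => c' s - σ' s • γ' (σ s)) ?_ (by simp [hσa, hca])
    (by rwa [← hI]) ?_ ?_ ?_
  · obtain ⟨h1, h2⟩ := key
    refine ⟨by by_contra! hlt; nlinarith, fun hvh s hs => sub_eq_zero.1 (h2 ?_ s (hI ▸ hs))⟩
    exact mul_nonneg (by linarith) (by linarith)
  -- At both ends c − γ ∘ σ vanishes, so only (h − v²/2) σ contributes to the increment.
  · simp only [hσa, hσb, hca, hcb, sub_self, map_zero]; ring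
  · rw [← hI]
    filter_upwards [hc', hσ', hσ0, hspeed] with s h1 h2 h3 h4 hs
    obtain ⟨F', hF', hle⟩ := exists_hasDerivAt_calibration_le (hγ _ (hσI hs)) (hp _ (hσI hs))
      (h1 hs) (h2 hs) (h3 hs) (hH _ _) (h4 hs _) (hres s hs (σ s) (hσI hs) _ rfl)
    have : HasDerivAt _ F' s := hF'
    exact this.deriv.trans_le hle
  · rw [← hI]
    filter_upwards [hc', hσ'] with s h1 h2 hs
    exact (h1 hs).sub ((hγ _ (hσI hs)).scomp s (h2 hs))
  · rw [← hI]
    filter_upwards [hspeed] with s h6 hs h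
    -- Testing the speed bound on the covector dual to c' gives |c'|² ≤ 0 where σ' = 0.
    have := h6 hs (innerSL ℝ (c' s))
    rw [h, mul_zero, mul_zero, innerSL_apply_apply] at this
    simp [h, real_inner_self_nonpos.1 this]

end Analysis

set_option linter.unusedSectionVars false

/-! ### Canonical coordinates on the cotangent bundle and their changes. -/

section Charts

variable {n : ℕ} {M : Type*} [TopologicalSpace M] [ChartedSpace (Eucl n) M]
  [IsManifold (𝓡 n) ∞ M]

/-- The differential at `x` of the preferred chart at `c`. -/
noncomputable def chartDiff (c x : M) : TangentSpace (𝓡 n) x →L[ℝ] Eucl n :=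
  mfderiv (𝓡 n) 𝓘(ℝ, Eucl n) (extChartAt (𝓡 n) c) x

instance isManifold_one : IsManifold (𝓡 n) 1 M := IsManifold.of_le (n := ∞) (by decide)

theorem isInvertible_chartDiff {c x : M} (hx : x ∈ (extChartAt (𝓡 n) c).source) :
    (chartDiff (n := n) c x).IsInvertible := isInvertible_mfderiv_extChartAt hx

theorem chartDiff_inverse_comp {c x : M} (hx : x ∈ (extChartAt (𝓡 n) c).source) :
    (chartDiff (n := n) c x).inverse ∘L chartDiff c x = ContinuousLinearMap.id ℝ _ :=
  (isInvertible_chartDiff hx).inverse_comp_self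

theorem chartDiff_comp_inverse {c x : M} (hx : x ∈ (extChartAt (𝓡 n) c).source) :
    chartDiff (n := n) c x ∘L (chartDiff (n := n) c x).inverse = ContinuousLinearMap.id ℝ _ :=
  (isInvertible_chartDiff hx).self_comp_inverse

theorem chartDiff_injective {c x : M} (hx : x ∈ (extChartAt (𝓡 n) c).source) :
    Function.Injective (chartDiff (n := n) c x) := fun v w h => by
  have h1 := DFunLike.congr_fun (chartDiff_inverse_comp hx) v
  have h2 := DFunLike.congr_fun (chartDiff_inverse_comp hx) w
  simp only [ContinuousLinearMap.comp_apply, ContinuousLinearMap.id_apply] at h1 h2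
  rw [← h1, ← h2, h]

theorem cotangentCoordSymm_cotangentCoord {c : M} {ξ : CotangentBundle n M}
    (hx : ξ.1 ∈ (extChartAt (𝓡 n) c).source) :
    cotangentCoordSymm c (cotangentCoord c ξ) = ξ := by
  obtain ⟨x, p⟩ := ξ
  have hx' : x ∈ (extChartAt (𝓡 n) c).source := hx
  have h := (extChartAt (𝓡 n) c).left_inv hx'
  change (⟨(extChartAt (𝓡 n) c).symm (extChartAt (𝓡 n) c x), (p ∘L (chartDiff c x).inverse) ∘L
    chartDiff c ((extChartAt (𝓡 n) c).symm (extChartAt (𝓡 n) c x))⟩ : CotangentBundle n M) = _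
  -- The covectors lie in fibres over propositionally equal points; the base points are identified
  -- before the covectors are compared.
  generalize (extChartAt (𝓡 n) c).symm (extChartAt (𝓡 n) c x) = y at h
  subst h
  rw [ContinuousLinearMap.comp_assoc, chartDiff_inverse_comp hx']
  rfl

theorem cotangentCoord_cotangentCoordSymm {c : M} {z : PhaseSpace n}
    (hz : z.1 ∈ (extChartAt (𝓡 n) c).target) :
    cotangentCoord c (cotangentCoordSymm c z) = z := by
  refine Prod.ext ((extChartAt (𝓡 n) c).right_inv hz) ?_
  change (z.2 ∘L chartDiff c ((extChartAt (𝓡 n) c).symm z.1)) ∘L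
    (chartDiff c ((extChartAt (𝓡 n) c).symm z.1)).inverse = z.2
  rw [ContinuousLinearMap.comp_assoc,
    chartDiff_comp_inverse ((extChartAt (𝓡 n) c).map_target hz)]
  rfl

/-- The transition function from the preferred chart at `c` to that at `d`. -/
noncomputable def transition (c d : M) (q : Eucl n) : Eucl n :=
  extChartAt (𝓡 n) d ((extChartAt (𝓡 n) c).symm q)

/-- The domain of the transition function. -/
def transitionDomain (c d : M) : Set (Eucl n) :=
  (extChartAt (𝓡 n) c).target ∩ (extChartAt (𝓡 n) c).symm ⁻¹' (extChartAt (𝓡 n) d).source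

theorem isOpen_transitionDomain (c d : M) : IsOpen (transitionDomain (n := n) c d) :=
  (continuousOn_extChartAt_symm c).isOpen_inter_preimage (isOpen_extChartAt_target c)
    (isOpen_extChartAt_source d)

theorem contDiffOn_transition (c d : M) :
    ContDiffOn ℝ ∞ (transition (n := n) c d) (transitionDomain c d) :=
  contDiffOn_ext_coord_change (I := 𝓡 n) (n := ∞) d c

theorem mem_transitionDomain {c d x : M} (hc : x ∈ (extChartAt (𝓡 n) c).source)
    (hd : x ∈ (extChartAt (𝓡 n) d).source) : extChartAt (𝓡 n) c x ∈ transitionDomain c d :=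
  ⟨(extChartAt (𝓡 n) c).map_source hc, by
    simpa only [mem_preimage, (extChartAt (𝓡 n) c).left_inv hc] using hd⟩

theorem differentiableAt_transition {c d x : M} (hc : x ∈ (extChartAt (𝓡 n) c).source)
    (hd : x ∈ (extChartAt (𝓡 n) d).source) :
    DifferentiableAt ℝ (transition c d) (extChartAt (𝓡 n) c x) :=
  ((contDiffOn_transition c d).contDiffAt ((isOpen_transitionDomain c d).mem_nhds
    (mem_transitionDomain hc hd))).differentiableAt (by decide)

theorem fderiv_transition_comp_chartDiff {c d x : M} (hc : x ∈ (extChartAt (𝓡 n) c).source)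
    (hd : x ∈ (extChartAt (𝓡 n) d).source) :
    fderiv ℝ (transition c d) (extChartAt (𝓡 n) c x) ∘L chartDiff c x = chartDiff d x := by
  have h1 : (extChartAt (𝓡 n) d) =ᶠ[𝓝 x] (transition c d) ∘ (extChartAt (𝓡 n) c) := by
    filter_upwards [(isOpen_extChartAt_source c).mem_nhds hc] with y hy
    rw [Function.comp_apply, transition, (extChartAt (𝓡 n) c).left_inv hy]
  have h2 := (differentiableAt_transition hc hd).mdifferentiableAt
  have h3 := mdifferentiableAt_extChartAt (I := 𝓡 n) (by rwa [extChartAt_source] at hc)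
  have h4 := mfderiv_comp x h2 h3
  rw [← h1.mfderiv_eq, mfderiv_eq_fderiv] at h4
  exact h4.symm

/-- A velocity vector in coordinates. -/
theorem hasDerivAt_extChartAt_comp {γ : ℝ → M} {t : ℝ} {c : M}
    (hγ : MDifferentiableAt 𝓘(ℝ, ℝ) (𝓡 n) γ t) (hc : γ t ∈ (extChartAt (𝓡 n) c).source) :
    HasDerivAt (fun s => extChartAt (𝓡 n) c (γ s)) (chartDiff c (γ t) (velocity γ t)) t := by
  have h3 := mdifferentiableAt_extChartAt (I := 𝓡 n) (by rwa [extChartAt_source] at hc)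
  have h4 := (h3.comp t hγ).differentiableAt
  have h5 := h4.hasDerivAt
  have h6 := mfderiv_comp t h3 hγ
  rw [mfderiv_eq_fderiv] at h6
  have h7 := DFunLike.congr_fun h6 (1 : ℝ)
  convert! h5 using 1
  exact h7.symm

theorem mdifferentiableAt_of_hasDerivAt {γ : ℝ → M} {t : ℝ} {c : M} (hγ : ContinuousAt γ t)
    (hc : γ t ∈ (extChartAt (𝓡 n) c).source) {v : TangentSpace (𝓡 n) (γ t)}
    (h : HasDerivAt (fun s => extChartAt (𝓡 n) c (γ s)) (chartDiff c (γ t) v) t) :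
    MDifferentiableAt 𝓘(ℝ, ℝ) (𝓡 n) γ t ∧ velocity γ t = v := by
  have hc' : γ t ∈ (chartAt (Eucl n) c).source := by rwa [extChartAt_source] at hc
  have h1 : MDifferentiableAt 𝓘(ℝ, ℝ) (𝓡 n) γ t :=
    (mdifferentiableAt_iff_target_of_mem_source hc').2
      ⟨hγ, h.differentiableAt.mdifferentiableAt⟩
  exact ⟨h1, chartDiff_injective hc ((hasDerivAt_extChartAt_comp h1 hc).unique h)⟩

/-- Momenta transform by the differential of the inverse transition map at the image point. This
formula is differentiated later to change charts along a curve. -/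
theorem cotangentCoord_cotangentCoordSymm_eq {c d : M} {z : PhaseSpace n}
    (hz : z.1 ∈ transitionDomain c d) :
    cotangentCoord d (cotangentCoordSymm c z) =
      (transition c d z.1, z.2 ∘L fderiv ℝ (transition d c) (transition c d z.1)) := by
  refine Prod.ext rfl ?_
  obtain ⟨h1, h2⟩ := hz
  have h3 := fderiv_transition_comp_chartDiff h2 ((extChartAt (𝓡 n) c).map_target h1)
  change (z.2 ∘L chartDiff c ((extChartAt (𝓡 n) c).symm z.1)) ∘L
    (chartDiff d ((extChartAt (𝓡 n) c).symm z.1)).inverse = _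
  rw [← h3, ContinuousLinearMap.comp_assoc, ContinuousLinearMap.comp_assoc,
    chartDiff_comp_inverse h2]
  rfl

end Charts

/-! ### The frame, the Hamiltonian and its vector field in coordinates. -/

section Frame

variable {n m : ℕ} {M : Type*} [TopologicalSpace M] [ChartedSpace (Eucl n) M]
  [IsManifold (𝓡 n) ∞ M] (S : SubRiemannianStructure n m M)

namespace SubRiemannianStructure

/-- The frame in the preferred chart at `c`. -/
noncomputable def frameCoord (c : M) (i : Fin m) (q : Eucl n) : Eucl n :=
  chartDiff c ((extChartAt (𝓡 n) c).symm q) (S.frame i ((extChartAt (𝓡 n) c).symm q))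

/-- Over the chart domain, the trivialization of the tangent bundle at c is the differential of the
chart, so smoothness of the section gives smoothness of its coordinates. -/
theorem contDiffOn_frameCoord (c : M) (i : Fin m) :
    ContDiffOn ℝ ∞ (S.frameCoord c i) (extChartAt (𝓡 n) c).target := by
  have h1 : ContMDiffOn (𝓡 n) (𝓡 n).tangent ∞
      (fun x => (⟨x, S.frame i x⟩ : TangentBundle (𝓡 n) M)) (chartAt (Eucl n) c).source :=
    (S.smooth i).contMDiffOn
  have h2 := ((trivializationAt (Eucl n) (TangentSpace (𝓡 n)) c).contMDiffOn_section_iff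
    (chartAt (Eucl n) c).open_source (by simp)).1 h1
  have h3 := h2.comp (contMDiffOn_extChartAt_symm (I := 𝓡 n) (n := ∞) c) (by
    intro q hq
    simpa only [mem_preimage, ← extChartAt_source (𝓡 n)] using (extChartAt (𝓡 n) c).map_target hq)
  refine h3.contDiffOn.congr fun q hq => ?_
  have hq' : (extChartAt (𝓡 n) c).symm q ∈ (chartAt (Eucl n) c).source := by
    simpa only [← extChartAt_source (𝓡 n)] using (extChartAt (𝓡 n) c).map_target hq
  have := TangentBundle.continuousLinearMapAt_trivializationAt (I := 𝓡 n) (𝕜 := ℝ) hq'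
  have h5 := DFunLike.congr_fun this (S.frame i ((extChartAt (𝓡 n) c).symm q))
  rw [Bundle.Trivialization.continuousLinearMapAt_apply] at h5
  rw [frameCoord, chartDiff, ← h5]
  rw [Bundle.Trivialization.linearMapAt_apply, if_pos]
  · rfl
  · simpa using hq'

theorem frameCoord_extChartAt {c x : M} (hx : x ∈ (extChartAt (𝓡 n) c).source) (i : Fin m) :
    S.frameCoord c i (extChartAt (𝓡 n) c x) = chartDiff c x (S.frame i x) := by
  rw [frameCoord, (extChartAt (𝓡 n) c).left_inv hx]

theorem chartDiff_comb {c x : M} (hx : x ∈ (extChartAt (𝓡 n) c).source) (u : Eucl m) :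
    chartDiff c x (S.comb x u) = ∑ i, u i • S.frameCoord c i (extChartAt (𝓡 n) c x) := by
  simp only [comb, map_sum, map_smul, S.frameCoord_extChartAt hx]

theorem frameCoord_transition {c d : M} {q : Eucl n} (hq : q ∈ transitionDomain c d) (i : Fin m) :
    S.frameCoord d i (transition c d q) = fderiv ℝ (transition c d) q (S.frameCoord c i q) := by
  have h1 := (extChartAt (𝓡 n) c).map_target hq.1
  have h2 := fderiv_transition_comp_chartDiff h1 hq.2
  rw [transition, S.frameCoord_extChartAt hq.2, ← h2, (extChartAt (𝓡 n) c).right_inv hq.1]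
  rfl

/-- The Hamiltonian in canonical coordinates. -/
noncomputable def hamCoord (c : M) (z : PhaseSpace n) : ℝ :=
  1 / 2 * ∑ i, (z.2 (S.frameCoord c i z.1)) ^ 2

theorem hamiltonian_cotangentCoordSymm (c : M) (z : PhaseSpace n) :
    S.hamiltonian (cotangentCoordSymm c z) = S.hamCoord c z := rfl

theorem hamCoord_cotangentCoord {c : M} {ξ : CotangentBundle n M}
    (hx : ξ.1 ∈ (extChartAt (𝓡 n) c).source) :
    S.hamCoord c (cotangentCoord c ξ) = S.hamiltonian ξ := by
  rw [← hamiltonian_cotangentCoordSymm, cotangentCoordSymm_cotangentCoord hx]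

theorem hamCoord_nonneg (c : M) (z : PhaseSpace n) : 0 ≤ S.hamCoord c z := by
  unfold hamCoord; positivity

/-- The Hamiltonian vector field in canonical coordinates. -/
noncomputable def hamField (c : M) (z : PhaseSpace n) : PhaseSpace n :=
  (∑ i, z.2 (S.frameCoord c i z.1) • S.frameCoord c i z.1,
    -∑ i, z.2 (S.frameCoord c i z.1) • (z.2 ∘L fderiv ℝ (S.frameCoord c i) z.1))

theorem contDiffOn_hamCoord (c : M) :
    ContDiffOn ℝ ∞ (S.hamCoord c) ((extChartAt (𝓡 n) c).target ×ˢ univ) := by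
  unfold hamCoord
  refine contDiffOn_const.mul (ContDiffOn.sum fun i _ => ?_)
  have := (S.contDiffOn_frameCoord c i).comp (t := (extChartAt (𝓡 n) c).target)
    (contDiffOn_fst (s := (extChartAt (𝓡 n) c).target ×ˢ (univ : Set (Eucl n →L[ℝ] ℝ))))
    (fun z hz => hz.1)
  exact (contDiffOn_snd.clm_apply this).pow 2

theorem contDiffOn_hamField (c : M) :
    ContDiffOn ℝ 1 (S.hamField c) ((extChartAt (𝓡 n) c).target ×ˢ univ) := by
  have hf : ∀ i, ContDiffOn ℝ 1 (fun z : PhaseSpace n => S.frameCoord c i z.1)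
      ((extChartAt (𝓡 n) c).target ×ˢ univ) := fun i =>
    ((S.contDiffOn_frameCoord c i).of_le (by decide)).comp contDiffOn_fst (fun z hz => hz.1)
  have hf' : ∀ i, ContDiffOn ℝ 1 (fun z : PhaseSpace n => fderiv ℝ (S.frameCoord c i) z.1)
      ((extChartAt (𝓡 n) c).target ×ˢ univ) := fun i =>
    (((S.contDiffOn_frameCoord c i).fderiv_of_isOpen (m := 1) (isOpen_extChartAt_target c)
      (by decide))).comp contDiffOn_fst (fun z hz => hz.1)
  unfold hamField
  refine ContDiffOn.prodMk (ContDiffOn.sum fun i _ => ?_) (ContDiffOn.sum fun i _ => ?_).neg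
  · exact (contDiffOn_snd.clm_apply (hf i)).smul (hf i)
  · exact (contDiffOn_snd.clm_apply (hf i)).smul (contDiffOn_snd.clm_comp (hf' i))

theorem differentiableAt_frameCoord {c : M} {q : Eucl n} (hq : q ∈ (extChartAt (𝓡 n) c).target)
    (i : Fin m) : DifferentiableAt ℝ (S.frameCoord c i) q :=
  ((S.contDiffOn_frameCoord c i).contDiffAt
    ((isOpen_extChartAt_target c).mem_nhds hq)).differentiableAt (by decide)

theorem fderiv_hamCoord_apply {c : M} {z : PhaseSpace n}
    (hz : z.1 ∈ (extChartAt (𝓡 n) c).target) (v : PhaseSpace n) :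
    fderiv ℝ (S.hamCoord c) z v = symplecticForm v (S.hamField c z) := by
  have h1 : ∀ i, HasFDerivAt (fun z : PhaseSpace n => S.frameCoord c i z.1)
      (fderiv ℝ (S.frameCoord c i) z.1 ∘L ContinuousLinearMap.fst ℝ _ _) z := fun i =>
    (S.differentiableAt_frameCoord hz i).hasFDerivAt.comp z hasFDerivAt_fst
  have h2 := fun i => ((hasFDerivAt_snd (𝕜 := ℝ) (p := z)).clm_apply (h1 i)).pow 2
  have h3 := (HasFDerivAt.fun_sum (u := Finset.univ) fun i _ => h2 i).const_mul (1 / 2)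
  have h4 : HasFDerivAt (S.hamCoord c) _ z := h3
  rw [h4.fderiv]
  simp [symplecticForm, hamField, Finset.mul_sum, ← Finset.sum_add_distrib]
  exact Finset.sum_congr rfl fun i _ => by ring

/-- Nondegeneracy of σ: test vectors (0, ⟨v, ·⟩) recover the position part and (v, 0) the momentum
part. -/
theorem symplecticForm_eq_iff {c : M} {z w : PhaseSpace n}
    (hz : z.1 ∈ (extChartAt (𝓡 n) c).target) :
    (∀ v, symplecticForm v w = fderiv ℝ (S.hamCoord c) z v) ↔ w = S.hamField c z := by
  simp only [S.fderiv_hamCoord_apply hz]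
  refine ⟨fun h => ?_, fun h v => by rw [h]⟩
  generalize S.hamField c z = w' at h
  refine Prod.ext ?_ ?_
  · refine ext_inner_left ℝ fun v => ?_
    simpa [symplecticForm] using h (0, innerSL ℝ v)
  · ext v
    simpa [symplecticForm] using h (v, 0)

end SubRiemannianStructure

end Frame

/-! ### Hamiltonian curves: independence of the chart and conservation of energy. -/

section HamiltonianCurves

variable {n m : ℕ} {M : Type*} [TopologicalSpace M] [ChartedSpace (Eucl n) M]
  [IsManifold (𝓡 n) ∞ M] (S : SubRiemannianStructure n m M)

theorem transition_transition {c d : M} {q : Eucl n} (hq : q ∈ transitionDomain c d) :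
    transition d c (transition c d q) = q := by
  rw [transition, transition, (extChartAt (𝓡 n) d).left_inv hq.2,
    (extChartAt (𝓡 n) c).right_inv hq.1]

theorem transition_mem {c d : M} {q : Eucl n} (hq : q ∈ transitionDomain c d) :
    transition c d q ∈ transitionDomain d c :=
  mem_transitionDomain hq.2 ((extChartAt (𝓡 n) c).map_target hq.1)

theorem cotangentCoord_fst_mem {c : M} {ξ : CotangentBundle n M}
    (hc : ξ.1 ∈ (extChartAt (𝓡 n) c).source) :
    (cotangentCoord c ξ).1 ∈ (extChartAt (𝓡 n) c).target := (extChartAt (𝓡 n) c).map_source hc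

namespace SubRiemannianStructure

theorem isOpen_phaseDomain (c : M) :
    IsOpen ((extChartAt (𝓡 n) c).target ×ˢ (univ : Set (Eucl n →L[ℝ] ℝ))) :=
  (isOpen_extChartAt_target c).prod isOpen_univ

theorem differentiableAt_hamCoord {c : M} {z : PhaseSpace n}
    (hz : z.1 ∈ (extChartAt (𝓡 n) c).target) : DifferentiableAt ℝ (S.hamCoord c) z := by
  have hz' : z ∈ (extChartAt (𝓡 n) c).target ×ˢ (univ : Set (Eucl n →L[ℝ] ℝ)) := ⟨hz, mem_univ _⟩
  have h1 := (S.contDiffOn_hamCoord c).contDiffAt ((isOpen_phaseDomain c).mem_nhds hz')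
  exact h1.differentiableAt (by decide)

/-- Obtained by differentiating `frameCoord_transition`. The second derivative of the transition map
appears, and has to cancel in the momentum equation. -/
theorem fderiv_frameCoord_transition {c d : M} {q : Eucl n} (hq : q ∈ transitionDomain c d)
    (i : Fin m) (v : Eucl n) :
    fderiv ℝ (S.frameCoord d i) (transition c d q) (fderiv ℝ (transition c d) q v) =
      fderiv ℝ (fderiv ℝ (transition c d)) q v (S.frameCoord c i q) +
        fderiv ℝ (transition c d) q (fderiv ℝ (S.frameCoord c i) q v) := by
  have hcd := (contDiffOn_transition c d).contDiffAt ((isOpen_transitionDomain c d).mem_nhds hq)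
  have h1 : (fun y => S.frameCoord d i (transition c d y)) =ᶠ[𝓝 q]
      fun y => fderiv ℝ (transition c d) y (S.frameCoord c i y) := by
    filter_upwards [(isOpen_transitionDomain c d).mem_nhds hq] with y hy
    exact S.frameCoord_transition hy i
  have h2 := (hcd.differentiableAt (by decide)).hasFDerivAt
  have h3 := (S.differentiableAt_frameCoord (transition_mem hq).1 i).hasFDerivAt.comp q h2
  have h4 : DifferentiableAt ℝ (fderiv ℝ (transition c d)) q :=
    (hcd.fderiv_right (m := 1) (by decide)).differentiableAt (by decide)
  have h5 := h4.hasFDerivAt.clm_apply (S.differentiableAt_frameCoord hq.1 i).hasFDerivAt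
  have h6 := (h5.congr_of_eventuallyEq h1).unique h3
  have h7 := DFunLike.congr_fun h6 v
  simp at h7
  rw [← h7, add_comm]

/-- The Hamiltonian vector field does not depend on the canonical coordinates. -/
theorem hasDerivAt_cotangentCoord_change {ξ : ℝ → CotangentBundle n M} {t : ℝ} {c d : M}
    (hξ : ContinuousAt (fun s => (ξ s).1) t) (hc : (ξ t).1 ∈ (extChartAt (𝓡 n) c).source)
    (hd : (ξ t).1 ∈ (extChartAt (𝓡 n) d).source)
    (h : HasDerivAt (fun s => cotangentCoord c (ξ s)) (S.hamField c (cotangentCoord c (ξ t))) t) :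
    HasDerivAt (fun s => cotangentCoord d (ξ s)) (S.hamField d (cotangentCoord d (ξ t))) t := by
  have heq : ∀ s, (ξ s).1 ∈ (extChartAt (𝓡 n) c).source → (ξ s).1 ∈ (extChartAt (𝓡 n) d).source →
      cotangentCoord d (ξ s) = (transition c d (cotangentCoord c (ξ s)).1, (cotangentCoord c (ξ s)).2
        ∘L fderiv ℝ (transition d c) (transition c d (cotangentCoord c (ξ s)).1)) := by
    intro s h1 h2
    rw [← cotangentCoord_cotangentCoordSymm_eq, cotangentCoordSymm_cotangentCoord h1]
    exact mem_transitionDomain h1 h2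
  have hev : (fun s => cotangentCoord d (ξ s)) =ᶠ[𝓝 t] fun s =>
      (transition c d (cotangentCoord c (ξ s)).1, (cotangentCoord c (ξ s)).2
        ∘L fderiv ℝ (transition d c) (transition c d (cotangentCoord c (ξ s)).1)) := by
    filter_upwards [hξ.eventually ((isOpen_extChartAt_source c).mem_nhds hc),
      hξ.eventually ((isOpen_extChartAt_source d).mem_nhds hd)] with s h1 h2
    exact heq s h1 h2
  refine HasDerivAt.congr_of_eventuallyEq ?_ hev
  rw [heq t hc hd]
  have hq : (cotangentCoord c (ξ t)).1 ∈ transitionDomain c d := mem_transitionDomain hc hd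
  generalize hz : cotangentCoord c (ξ t) = z at *
  obtain ⟨q, p⟩ := z
  have hq1 : HasDerivAt (fun s => (cotangentCoord c (ξ s)).1) (S.hamField c (q, p)).1 t := h.fst
  have hp1 : HasDerivAt (fun s => (cotangentCoord c (ξ s)).2) (S.hamField c (q, p)).2 t := h.snd
  have hcd := (contDiffOn_transition c d).contDiffAt ((isOpen_transitionDomain c d).mem_nhds hq)
  have hdc := (contDiffOn_transition d c).contDiffAt
    ((isOpen_transitionDomain d c).mem_nhds (transition_mem hq))
  have hT : HasFDerivAt (transition c d) (fderiv ℝ (transition c d) q)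
      ((fun s => (cotangentCoord c (ξ s)).1) t) := by
    simp only [hz]; exact (hcd.differentiableAt (by decide)).hasFDerivAt
  have hT1 := hT.comp_hasDerivAt t hq1
  have hD : HasFDerivAt (fderiv ℝ (transition d c))
      (fderiv ℝ (fderiv ℝ (transition d c)) (transition c d q))
      ((transition c d ∘ fun s => (cotangentCoord c (ξ s)).1) t) := by
    simp only [Function.comp, hz]
    exact ((hdc.fderiv_right (m := 1) (by decide)).differentiableAt (by decide)).hasFDerivAt
  have hD1 := hD.comp_hasDerivAt t hT1
  convert! hT1.prodMk (hp1.clm_comp hD1) using 1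
  have hX : ∀ i, S.frameCoord d i (transition c d q) =
      fderiv ℝ (transition c d) q (S.frameCoord c i q) := S.frameCoord_transition hq
  have hX' : ∀ i, fderiv ℝ (transition d c) (transition c d q)
      (S.frameCoord d i (transition c d q)) = S.frameCoord c i q := fun i => by
    rw [← S.frameCoord_transition (transition_mem hq), transition_transition hq]
  -- One second derivative term comes from the frame, the other from differentiating the momentum
  -- formula along the curve. Their arguments are swapped, so they cancel by symmetry.
  have hsymm : IsSymmSndFDerivAt ℝ (transition d c) (transition c d q) :=
    hdc.isSymmSndFDerivAt (by simp; decide)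
  refine Prod.ext ?_ ?_
  · simp only [hamField, ContinuousLinearMap.comp_apply, hX', map_sum, map_smul]
    simp only [hX]
  · ext v
    have hdX := fun i => S.fderiv_frameCoord_transition (transition_mem hq) i v
    rw [transition_transition hq] at hdX
    simp only [Function.comp, hz, hamField, ContinuousLinearMap.comp_apply, hX', map_sum, map_smul,
      ← hX, neg_apply, add_apply, sum_apply, smul_apply, hdX, map_add, smul_eq_mul, mul_add,
      Finset.sum_add_distrib, hsymm.eq v]
    ring

theorem isHamiltonianCurve_iff {ξ : ℝ → CotangentBundle n M} :
    IsHamiltonianCurve S.hamiltonian ξ ↔ Continuous (fun t => (ξ t).1) ∧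
      ∀ t c, (ξ t).1 ∈ (extChartAt (𝓡 n) c).source →
        HasDerivAt (fun s => cotangentCoord c (ξ s)) (S.hamField c (cotangentCoord c (ξ t))) t := by
  refine and_congr_right fun _ => forall₂_congr fun t c => ?_
  rw [extChartAt_source]
  refine forall_congr' fun hc => ?_
  rw [← extChartAt_source (𝓡 n)] at hc
  have hz := cotangentCoord_fst_mem hc
  constructor
  · rintro ⟨w, h1, h2⟩
    rwa [← (S.symplecticForm_eq_iff hz).1 h2]
  · exact fun h => ⟨_, h, (S.symplecticForm_eq_iff hz).2 rfl⟩

/-- `ξ` is an integral curve of the Hamiltonian vector field at the time `t`. -/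
def IsHamAt (ξ : ℝ → CotangentBundle n M) (t : ℝ) : Prop :=
  ContinuousAt (fun s => (ξ s).1) t ∧ ∀ c, (ξ t).1 ∈ (extChartAt (𝓡 n) c).source →
    HasDerivAt (fun s => cotangentCoord c (ξ s)) (S.hamField c (cotangentCoord c (ξ t))) t

theorem isHamiltonianCurve_iff_isHamAt {ξ : ℝ → CotangentBundle n M} :
    IsHamiltonianCurve S.hamiltonian ξ ↔ ∀ t, S.IsHamAt ξ t := by
  rw [S.isHamiltonianCurve_iff, continuous_iff_continuousAt, ← forall_and]; rfl

variable {S}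

theorem IsHamAt.congr {ξ ζ : ℝ → CotangentBundle n M} {t : ℝ} (h : S.IsHamAt ξ t)
    (heq : ξ =ᶠ[𝓝 t] ζ) : S.IsHamAt ζ t := by
  refine ⟨h.1.congr (heq.mono fun s hs => by simp [hs]), fun c hc => ?_⟩
  rw [← heq.eq_of_nhds] at hc ⊢
  exact (h.2 c hc).congr_of_eventuallyEq (heq.symm.mono fun s hs => by simp [hs])

theorem IsHamAt.comp_sub_const {ξ : ℝ → CotangentBundle n M} {t : ℝ} (r : ℝ)
    (h : S.IsHamAt ξ (t - r)) : S.IsHamAt (fun s => ξ (s - r)) t :=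
  ⟨ContinuousAt.comp (f := fun s : ℝ => s - r) (g := fun s => (ξ s).1) h.1 (by fun_prop),
    fun c hc => (h.2 c hc).comp_sub_const t r⟩

/-- The minimal control of the projection of a Hamiltonian curve. -/
theorem IsHamAt.velocity_eq {ξ : ℝ → CotangentBundle n M} {t : ℝ} (h : S.IsHamAt ξ t) :
    MDifferentiableAt 𝓘(ℝ, ℝ) (𝓡 n) (fun s => (ξ s).1) t ∧
      velocity (fun s => (ξ s).1) t =
        S.comb (ξ t).1 (WithLp.toLp 2 fun i => (ξ t).2 (S.frame i (ξ t).1)) := by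
  have hc := mem_extChartAt_source (I := 𝓡 n) (ξ t).1
  refine mdifferentiableAt_of_hasDerivAt h.1 hc ?_
  have hi : ∀ i, (cotangentCoord (ξ t).1 (ξ t)).2 (S.frameCoord (ξ t).1 i
      (extChartAt (𝓡 n) (ξ t).1 (ξ t).1)) = (ξ t).2 (S.frame i (ξ t).1) := fun i => by
    change ((ξ t).2 ∘L (chartDiff (ξ t).1 (ξ t).1).inverse) _ = _
    rw [S.frameCoord_extChartAt hc]
    exact congr_arg (ξ t).2 (DFunLike.congr_fun (chartDiff_inverse_comp hc) (S.frame i (ξ t).1))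
  have h1 : HasDerivAt (fun s => extChartAt (𝓡 n) (ξ t).1 (ξ s).1)
      (S.hamField (ξ t).1 (cotangentCoord (ξ t).1 (ξ t))).1 t := (h.2 _ hc).fst
  rw [S.chartDiff_comb hc]
  convert! h1 using 1
  exact Finset.sum_congr rfl fun i _ => congr_arg (fun r : ℝ => r •
    S.frameCoord (ξ t).1 i (extChartAt (𝓡 n) (ξ t).1 (ξ t).1)) (hi i).symm

theorem IsHamAt.hasDerivAt_hamiltonian {ξ : ℝ → CotangentBundle n M} {t : ℝ}
    (h : S.IsHamAt ξ t) : HasDerivAt (fun s => S.hamiltonian (ξ s)) 0 t := by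
  obtain ⟨x, hc⟩ : ∃ x, (ξ t).1 ∈ (extChartAt (𝓡 n) x).source := ⟨_, mem_extChartAt_source _⟩
  have h1 : (fun s => S.hamiltonian (ξ s)) =ᶠ[𝓝 t] fun s => S.hamCoord x (cotangentCoord x (ξ s)) := by
    filter_upwards [h.1.eventually ((isOpen_extChartAt_source x).mem_nhds hc)] with s hs
    exact (S.hamCoord_cotangentCoord hs).symm
  refine HasDerivAt.congr_of_eventuallyEq ?_ h1
  have hz := cotangentCoord_fst_mem hc
  have h3 := (S.differentiableAt_hamCoord hz).hasFDerivAt.comp_hasDerivAt t (h.2 x hc)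
  rw [S.fderiv_hamCoord_apply hz] at h3
  -- The derivative of H along its own field is σ evaluated twice on that field, hence zero.
  rw [symplecticForm, sub_self] at h3
  exact h3

theorem hamiltonian_eq_of_isHamAt {ξ : ℝ → CotangentBundle n M} {I : Set ℝ} (hI : Convex ℝ I)
    (h : ∀ t ∈ I, S.IsHamAt ξ t) {s t : ℝ} (hs : s ∈ I) (ht : t ∈ I) :
    S.hamiltonian (ξ s) = S.hamiltonian (ξ t) := by
  have := hI.norm_image_sub_le_of_norm_hasDerivWithin_le (C := 0)
    (fun r hr => ((h r hr).hasDerivAt_hamiltonian).hasDerivWithinAt) (by simp) ht hs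
  simpa [sub_eq_zero] using this

end SubRiemannianStructure

end HamiltonianCurves

/-- Only the positive part of f' is compared with G, inside a lower integral, so G need not be
measurable. It is applied with G the speed of a horizontal curve. -/
theorem _root_.AbsolutelyContinuousOnInterval.sub_le_of_deriv_le {f G : ℝ → ℝ} {a b C ℓ : ℝ}
    (hab : a ≤ b) (hf : AbsolutelyContinuousOnInterval f a b) (hC : 0 ≤ C) (hℓ : 0 ≤ ℓ)
    (hG : ∀ᵐ s, s ∈ Icc a b → deriv f s ≤ C * G s)
    (hGℓ : ∫⁻ s in Icc a b, ENNReal.ofReal (G s) ≤ ENNReal.ofReal ℓ) : f b - f a ≤ C * ℓ := by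
  have h1 := hf.integral_deriv_eq_sub
  have h2 := hf.intervalIntegrable_deriv
  rw [intervalIntegral.integral_of_le hab, ← integral_Icc_eq_integral_Ioc] at h1
  rw [intervalIntegrable_iff_integrableOn_Icc_of_le hab] at h2
  rw [← h1, integral_eq_lintegral_pos_part_sub_lintegral_neg_part h2]
  have h3 : ∫⁻ s in Icc a b, ENNReal.ofReal (deriv f s) ≤ ENNReal.ofReal (C * ℓ) := by
    calc _ ≤ ∫⁻ s in Icc a b, ENNReal.ofReal C * ENNReal.ofReal (G s) := by
          refine lintegral_mono_ae ?_
          rw [ae_restrict_iff' measurableSet_Icc]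
          filter_upwards [hG] with s hs hs'
          rw [← ENNReal.ofReal_mul hC]
          exact ENNReal.ofReal_le_ofReal (hs hs')
      _ = ENNReal.ofReal C * ∫⁻ s in Icc a b, ENNReal.ofReal (G s) :=
          lintegral_const_mul' _ _ ENNReal.ofReal_ne_top
      _ ≤ ENNReal.ofReal C * ENNReal.ofReal ℓ := by gcongr
      _ = _ := (ENNReal.ofReal_mul hC).symm
  have h4 := ENNReal.toReal_le_of_le_ofReal (mul_nonneg hC hℓ) h3
  linarith [ENNReal.toReal_nonneg (a := ∫⁻ s in Icc a b, ENNReal.ofReal (-deriv f s))]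

/-! ### A continuity argument for curves that cannot leave an open set. -/

section Exit

variable {X : Type*} [TopologicalSpace X]

/-- At the first time outside U, the value is a limit of points of the closed set K ⊆ U, a
contradiction. -/
theorem forall_mem_of_forall_forward {f : ℝ → X} {a b : ℝ} (hf : ContinuousOn f (Icc a b))
    {U K : Set X} (hU : IsOpen U) (hK : IsClosed K) (hKU : K ⊆ U) (ha : f a ∈ K)
    (h : ∀ t ∈ Icc a b, MapsTo f (Icc a t) U → f t ∈ K) : ∀ t ∈ Icc a b, f t ∈ U := by
  by_contra! hcon
  obtain ⟨t₁, ht₁, hf₁⟩ := hcon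
  have hN : IsClosed (Icc a b ∩ f ⁻¹' Uᶜ) := hf.preimage_isClosed_of_isClosed isClosed_Icc
    hU.isClosed_compl
  have hbdd : BddBelow (Icc a b ∩ f ⁻¹' Uᶜ) := ⟨a, fun t ht => ht.1.1⟩
  obtain ⟨h1, h2⟩ := hN.csInf_mem ⟨t₁, ht₁, hf₁⟩ hbdd
  set t₀ := sInf (Icc a b ∩ f ⁻¹' Uᶜ) with ht₀
  have hlt : a < t₀ := lt_of_le_of_ne h1.1 fun he => h2 (he ▸ hKU ha)
  have hbefore : ∀ t ∈ Ico a t₀, f t ∈ U := fun t ht => by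
    by_contra hn
    exact absurd (csInf_le hbdd ⟨⟨ht.1, ht.2.le.trans h1.2⟩, hn⟩) (not_le.2 ht.2)
  have hKt : ∀ t ∈ Ico a t₀, f t ∈ K := fun t ht =>
    h t ⟨ht.1, ht.2.le.trans h1.2⟩ fun s hs => hbefore s ⟨hs.1, hs.2.trans_lt ht.2⟩
  have hcont : ContinuousWithinAt f (Ico a t₀) t₀ :=
    (hf t₀ h1).mono fun t ht => ⟨ht.1, ht.2.le.trans h1.2⟩
  have hcl : t₀ ∈ closure (Ico a t₀) := by
    rw [closure_Ico hlt.ne]; exact right_mem_Icc.2 hlt.le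
  exact h2 (hKU (hK.closure_subset (hcont.mem_closure hcl hKt)))

/-- A curve that starts in `K` and comes back to `K` as long as it stays in `U` never leaves `U`. -/
theorem forall_mem_of_forall_subinterval {f : ℝ → X} {a b τ : ℝ} (hf : ContinuousOn f (Icc a b))
    {U K : Set X} (hU : IsOpen U) (hK : IsClosed K) (hKU : K ⊆ U) (hτ : τ ∈ Icc a b) (hfτ : f τ ∈ K)
    (h : ∀ s t, s ∈ Icc a b → t ∈ Icc a b → τ ∈ Icc s t → MapsTo f (Icc s t) U →
      f s ∈ K ∧ f t ∈ K) : ∀ t ∈ Icc a b, f t ∈ U := by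
  have hfw := forall_mem_of_forall_forward (hf.mono (Icc_subset_Icc_left hτ.1)) hU hK hKU hfτ
    fun t ht hm => (h τ t hτ ⟨hτ.1.trans ht.1, ht.2⟩ ⟨le_rfl, ht.1⟩ hm).2
  have hbw := forall_mem_of_forall_forward (f := fun t => f (-t)) (a := -τ) (b := -a)
    (hf.comp continuous_neg.continuousOn fun t ht =>
      ⟨by linarith [ht.2], by linarith [ht.1, hτ.2]⟩) hU hK hKU (by simpa using hfτ)
    fun t ht hm => (h (-t) τ ⟨by linarith [ht.2], by linarith [ht.1, hτ.2]⟩ hτ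
      ⟨by linarith [ht.1], le_rfl⟩ fun s hs => by
        simpa using hm (x := -s) ⟨by linarith [hs.2], by linarith [hs.1]⟩).1
  intro t ht
  rcases le_total τ t with h1 | h1
  · exact hfw t ⟨h1, ht.2⟩
  · simpa using hbw (-t) ⟨by linarith, by linarith [ht.1]⟩

end Exit

/-! ### Norm of horizontal vectors, and length against displacement in charts. -/

section Length

variable {n m : ℕ} {M : Type*} [TopologicalSpace M] [ChartedSpace (Eucl n) M]
  [IsManifold (𝓡 n) ∞ M] (S : SubRiemannianStructure n m M)

namespace SubRiemannianStructure

theorem sqNorm_nonneg (x : M) (v : TangentSpace (𝓡 n) x) : 0 ≤ S.sqNorm x v :=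
  Real.sInf_nonneg (by rintro r ⟨u, -, rfl⟩; positivity)

theorem sqNorm_comb_le (x : M) (u : Eucl m) : S.sqNorm x (S.comb x u) ≤ ∑ i, u i ^ 2 :=
  csInf_le ⟨0, by rintro r ⟨u, -, rfl⟩; positivity⟩ ⟨u, rfl, rfl⟩

/-- Reduces estimates in terms of `sqNorm`, an infimum, to estimates for an arbitrary control
producing the same vector. -/
theorem le_mul_sqrt_sqNorm {x : M} {u : Eucl m} {C r : ℝ} (hC : 0 ≤ C)
    (h : ∀ w : Eucl m, S.comb x w = S.comb x u → r ≤ C * √(∑ i, w i ^ 2)) :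
    r ≤ C * √(S.sqNorm x (S.comb x u)) := by
  rcases le_or_gt r 0 with hr | hr
  · exact hr.trans (by positivity)
  have hC' : 0 < C := lt_of_le_of_ne hC fun h0 => by
    have := h u rfl
    rw [← h0, zero_mul] at this
    linarith
  rw [← div_le_iff₀' hC']
  refine Real.le_sqrt_of_sq_le (le_csInf ⟨_, u, rfl, rfl⟩ ?_)
  rintro _ ⟨w, hw, rfl⟩
  have := (div_le_iff₀' hC').2 (h w hw)
  calc _ ≤ √(∑ i, w i ^ 2) ^ 2 := by gcongr
    _ = _ := Real.sq_sqrt (by positivity)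

theorem norm_chartDiff_comb_le {c x : M} (hx : x ∈ (extChartAt (𝓡 n) c).source) {B : ℝ}
    (hB0 : 0 ≤ B) (hB : ∀ i, ‖S.frameCoord c i (extChartAt (𝓡 n) c x)‖ ≤ B) (u : Eucl m) :
    ‖chartDiff c x (S.comb x u)‖ ≤ m * B * √(S.sqNorm x (S.comb x u)) := by
  refine S.le_mul_sqrt_sqNorm (by positivity) fun w hw => ?_
  rw [← hw, S.chartDiff_comb hx]
  calc _ ≤ ∑ i, ‖w i • S.frameCoord c i (extChartAt (𝓡 n) c x)‖ := norm_sum_le _ _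
    _ ≤ ∑ _i : Fin m, √(∑ i, w i ^ 2) * B := by
        refine Finset.sum_le_sum fun i _ => ?_
        rw [norm_smul]
        refine mul_le_mul ?_ (hB i) (norm_nonneg _) (by positivity)
        refine Real.le_sqrt_of_sq_le ?_
        rw [Real.norm_eq_abs, sq_abs]
        exact Finset.single_le_sum (f := fun i => w i ^ 2) (fun i _ => sq_nonneg _)
          (Finset.mem_univ i)
    _ = _ := by rw [Finset.sum_const, Finset.card_univ, Fintype.card_fin, nsmul_eq_mul]; ring

/-- Cauchy-Schwarz in the controls. This is the speed hypothesis of `calibration`. -/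
theorem apply_chartDiff_comb_le {c x : M} (hx : x ∈ (extChartAt (𝓡 n) c).source)
    (η : Eucl n →L[ℝ] ℝ) (u : Eucl m) :
    η (chartDiff c x (S.comb x u)) ≤ √(2 * S.hamCoord c (extChartAt (𝓡 n) c x, η)) *
      √(S.sqNorm x (S.comb x u)) := by
  refine S.le_mul_sqrt_sqNorm (by positivity) fun w hw => ?_
  rw [← hw, S.chartDiff_comb hx, mul_comm]
  simp only [map_sum, map_smul, smul_eq_mul]
  refine (Real.sum_mul_le_sqrt_mul_sqrt _ _ _).trans (le_of_eq ?_)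
  congr 2
  simp [hamCoord]

variable {S}

theorem IsHorizontal.mono {γ : ℝ → M} {a b s t : ℝ} (h : S.IsHorizontal γ a b)
    (hst : Icc s t ⊆ Icc a b) (hle : s ≤ t) : S.IsHorizontal γ s t := by
  obtain ⟨u, ⟨h1, h2⟩, h3, h4⟩ := h
  have hs := hst (left_mem_Icc.2 hle)
  have ht := hst (right_mem_Icc.2 hle)
  refine ⟨u, ⟨h1.mono hst, fun r r' c hr hrr hr' hm => h2 r r' c (hs.1.trans hr) hrr
    (hr'.trans ht.2) hm⟩, h3.mono_measure (Measure.restrict_mono_set _ hst),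
    ae_restrict_of_ae_restrict_of_subset hst h4⟩

theorem length_mono (γ : ℝ → M) {a b s t : ℝ} (hst : Icc s t ⊆ Icc a b) :
    S.length γ s t ≤ S.length γ a b := lintegral_mono_set hst

/-- The displacement of a horizontal curve in a chart is controlled by its length. -/
theorem IsHorizontal.norm_sub_le_of_mapsTo {γ : ℝ → M} {a b : ℝ} (h : S.IsHorizontal γ a b)
    (hab : a ≤ b) {c : M} (hc : MapsTo γ (Icc a b) (extChartAt (𝓡 n) c).source) {B ℓ : ℝ}
    (hB0 : 0 ≤ B) (hℓ0 : 0 ≤ ℓ)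
    (hB : ∀ t ∈ Icc a b, ∀ i, ‖S.frameCoord c i (extChartAt (𝓡 n) c (γ t))‖ ≤ B)
    (hℓ : S.length γ a b ≤ ENNReal.ofReal ℓ) :
    ‖extChartAt (𝓡 n) c (γ b) - extChartAt (𝓡 n) c (γ a)‖ ≤ m * B * ℓ := by
  obtain ⟨u, h1, -, h3⟩ := h
  have hAC := h1.2 a b c le_rfl hab le_rfl (by rwa [extChartAt_source] at hc)
  set q : ℝ → Eucl n := fun t => extChartAt (𝓡 n) c (γ t) with hq
  -- The curve is paired with its own total displacement, which reduces the estimate to a scalar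
  -- function.
  set w := q b - q a with hw
  have hfAC : AbsolutelyContinuousOnInterval (fun t => innerSL ℝ w (q t)) a b :=
    ((innerSL ℝ w).lipschitz.lipschitzOnWith (s := univ)).comp_absolutelyContinuousOnInterval hAC
      (mapsTo_univ _ _)
  have key := hfAC.sub_le_of_deriv_le (C := ‖w‖ * (m * B))
    (G := fun t => √(S.sqNorm (γ t) (velocity γ t))) hab (by positivity) hℓ0 ?_ hℓ
  · have h5 : innerSL ℝ w (q b) - innerSL ℝ w (q a) = ‖w‖ * ‖w‖ := by
      rw [← map_sub, ← hw, innerSL_apply_apply, real_inner_self_eq_norm_mul_norm]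
    rw [h5, mul_assoc] at key
    rcases (norm_nonneg w).eq_or_lt with h0 | h0
    · rw [← h0]; positivity
    · exact le_of_mul_le_mul_left key h0
  · rw [ae_restrict_iff' measurableSet_Icc] at h3
    filter_upwards [h3] with t ht hmem
    obtain ⟨h4, h5⟩ := ht hmem
    have h6 := (innerSL ℝ w).hasFDerivAt.comp_hasDerivAt t (hasDerivAt_extChartAt_comp h4 (hc hmem))
    have h7 : HasDerivAt (fun t => innerSL ℝ w (q t)) _ t := h6
    rw [h7.deriv, h5, innerSL_apply_apply]
    calc _ ≤ ‖w‖ * ‖chartDiff c (γ t) (S.comb (γ t) (u t))‖ := real_inner_le_norm _ _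
      _ ≤ ‖w‖ * (m * B * √(S.sqNorm (γ t) (S.comb (γ t) (u t)))) := by
          gcongr; exact S.norm_chartDiff_comb_le (hc hmem) hB0 (hB t hmem) _
      _ = _ := by ring

/-- A short horizontal curve through a point of a chart ball stays in the ball. -/
theorem IsHorizontal.mem_chart_of_length_le [T2Space M] {γ : ℝ → M} {a b : ℝ}
    (h : S.IsHorizontal γ a b) {c : M} {q₀ : Eucl n} {R B ℓ r : ℝ}
    (hR : Metric.closedBall q₀ R ⊆ (extChartAt (𝓡 n) c).target)
    (hB0 : 0 ≤ B) (hℓ0 : 0 ≤ ℓ) (hB : ∀ q ∈ Metric.closedBall q₀ R, ∀ i, ‖S.frameCoord c i q‖ ≤ B)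
    (hℓ : S.length γ a b ≤ ENNReal.ofReal ℓ) {τ : ℝ} (hτ : τ ∈ Icc a b)
    (hγτ : γ τ ∈ (extChartAt (𝓡 n) c).source)
    (hr : dist (extChartAt (𝓡 n) c (γ τ)) q₀ ≤ r) (hrR : r + m * B * ℓ < R) :
    ∀ t ∈ Icc a b, γ t ∈ (extChartAt (𝓡 n) c).source ∧
      dist (extChartAt (𝓡 n) c (γ t)) (extChartAt (𝓡 n) c (γ τ)) ≤ m * B * ℓ := by
  have hcont : ContinuousOn γ (Icc a b) := h.choose_spec.1.1
  set U : Set M := (extChartAt (𝓡 n) c).source ∩ extChartAt (𝓡 n) c ⁻¹' Metric.ball q₀ R with hU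
  -- The image of a compact ball is closed in the whole Hausdorff manifold, so a limit of points of
  -- K cannot fall outside the chart.
  set K : Set M := (extChartAt (𝓡 n) c).symm '' Metric.closedBall q₀ (r + m * B * ℓ) with hK
  have hUo : IsOpen U := (continuousOn_extChartAt c).isOpen_inter_preimage
    (isOpen_extChartAt_source c) Metric.isOpen_ball
  have hsub : Metric.closedBall q₀ (r + m * B * ℓ) ⊆ (extChartAt (𝓡 n) c).target :=
    (Metric.closedBall_subset_closedBall hrR.le).trans hR
  have hKc : IsClosed K := ((isCompact_closedBall q₀ _).image_of_continuousOn
    ((continuousOn_extChartAt_symm c).mono hsub)).isClosed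
  have hKU : K ⊆ U := by
    rintro _ ⟨q, hq, rfl⟩
    refine ⟨(extChartAt (𝓡 n) c).map_target (hsub hq), ?_⟩
    rw [mem_preimage, (extChartAt (𝓡 n) c).right_inv (hsub hq)]
    exact Metric.closedBall_subset_ball hrR hq
  have hmemK : ∀ x ∈ (extChartAt (𝓡 n) c).source,
      dist (extChartAt (𝓡 n) c x) (extChartAt (𝓡 n) c (γ τ)) ≤ m * B * ℓ → x ∈ K := by
    intro x hx hd
    refine ⟨extChartAt (𝓡 n) c x, ?_, (extChartAt (𝓡 n) c).left_inv hx⟩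
    rw [Metric.mem_closedBall]
    linarith [dist_triangle (extChartAt (𝓡 n) c x) (extChartAt (𝓡 n) c (γ τ)) q₀]
  have hdisp : ∀ s t, s ∈ Icc a b → t ∈ Icc a b → s ≤ t → MapsTo γ (Icc s t) U →
      ‖extChartAt (𝓡 n) c (γ t) - extChartAt (𝓡 n) c (γ s)‖ ≤ m * B * ℓ := by
    intro s t hs ht hst hm
    have hsub' : Icc s t ⊆ Icc a b := Icc_subset_Icc hs.1 ht.2
    exact (h.mono hsub' hst).norm_sub_le_of_mapsTo hst (fun r hr => (hm hr).1) hB0 hℓ0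
      (fun r hr i => hB _ (Metric.ball_subset_closedBall (hm hr).2) i)
      ((length_mono γ hsub').trans hℓ)
  have hmain := forall_mem_of_forall_subinterval hcont hUo hKc hKU hτ
    (hmemK _ hγτ (by rw [dist_self]; positivity)) fun s t hs ht hst hm => by
      constructor
      · refine hmemK _ (hm ⟨le_rfl, hst.1.trans hst.2⟩).1 ?_
        rw [dist_comm, dist_eq_norm]
        exact hdisp s τ hs hτ hst.1 fun r hr => hm ⟨hr.1, hr.2.trans hst.2⟩
      · refine hmemK _ (hm ⟨hst.1.trans hst.2, le_rfl⟩).1 ?_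
        rw [dist_eq_norm]
        exact hdisp τ t hτ ht hst.2 fun r hr => hm ⟨hst.1.trans hr.1, hr.2⟩
  intro t ht
  refine ⟨(hmain t ht).1, ?_⟩
  rcases le_total τ t with h1 | h1
  · rw [dist_eq_norm]
    exact hdisp τ t hτ ht h1 fun r hr => hmain r ⟨hτ.1.trans hr.1, hr.2.trans ht.2⟩
  · rw [dist_comm, dist_eq_norm]
    exact hdisp t τ ht hτ h1 fun r hr => hmain r ⟨ht.1.trans hr.1, hr.2.trans hτ.2⟩

/-- A differentiable curve with a continuous control is horizontal. -/
theorem isControlledBy_of_velocity_eq {γ : ℝ → M} {a b : ℝ} {u : ℝ → Eucl m}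
    (hγ : ∀ t ∈ Icc a b, MDifferentiableAt 𝓘(ℝ, ℝ) (𝓡 n) γ t ∧ velocity γ t = S.comb (γ t) (u t))
    (hu : ContinuousOn u (Icc a b)) : S.IsControlledBy γ a b u := by
  have hcont : ContinuousOn γ (Icc a b) := fun t ht => (hγ t ht).1.continuousAt.continuousWithinAt
  refine ⟨⟨hcont, fun s t c has hst htb hm => ?_⟩, ?_, ?_⟩
  · have hsub : Icc s t ⊆ Icc a b := Icc_subset_Icc has htb
    rw [← extChartAt_source (𝓡 n)] at hm
    have hd : ∀ r ∈ Icc s t, HasDerivWithinAt (fun r => extChartAt (𝓡 n) c (γ r))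
        (∑ i, u r i • S.frameCoord c i (extChartAt (𝓡 n) c (γ r))) (Icc s t) r := fun r hr => by
      have := hasDerivAt_extChartAt_comp (hγ r (hsub hr)).1 (hm hr)
      rw [(hγ r (hsub hr)).2, S.chartDiff_comb (hm hr)] at this
      exact this.hasDerivWithinAt
    have hq : ContinuousOn (fun r => extChartAt (𝓡 n) c (γ r)) (Icc s t) := fun r hr =>
      (hd r hr).continuousWithinAt
    have hdc : ContinuousOn (fun r => ∑ i, u r i • S.frameCoord c i (extChartAt (𝓡 n) c (γ r)))
        (Icc s t) := by
      refine continuousOn_finsetSum _ fun i _ => ?_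
      have h1 : ContinuousOn (fun r => u r i) (Icc s t) :=
        (EuclideanSpace.proj (𝕜 := ℝ) i).continuous.comp_continuousOn (hu.mono hsub)
      have h2 : ContinuousOn (fun r => S.frameCoord c i (extChartAt (𝓡 n) c (γ r))) (Icc s t) :=
        (S.contDiffOn_frameCoord c i).continuousOn.comp hq
          fun r hr => (extChartAt (𝓡 n) c).map_source (hm hr)
      exact h1.smul h2
    obtain ⟨C, hC⟩ := isCompact_Icc.exists_bound_of_continuousOn hdc
    refine LipschitzOnWith.absolutelyContinuousOnInterval (K := C.toNNReal) ?_
    rw [uIcc_of_le hst]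
    refine (convex_Icc s t).lipschitzOnWith_of_nnnorm_hasDerivWithin_le hd fun r hr => ?_
    rw [← NNReal.coe_le_coe, coe_nnnorm]
    exact (hC r hr).trans (Real.le_coe_toNNReal C)
  · obtain ⟨C, hC⟩ := isCompact_Icc.exists_bound_of_continuousOn hu
    refine MemLp.of_bound (hu.aestronglyMeasurable measurableSet_Icc) C ?_
    rw [ae_restrict_iff' measurableSet_Icc]
    exact Eventually.of_forall hC
  · rw [ae_restrict_iff' measurableSet_Icc]
    exact Eventually.of_forall hγ

theorem length_le_of_velocity_eq {γ : ℝ → M} {a b E : ℝ} {u : ℝ → Eucl m}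
    (hγ : ∀ t ∈ Icc a b, velocity γ t = S.comb (γ t) (u t))
    (hE : ∀ t ∈ Icc a b, ∑ i, u t i ^ 2 ≤ E) :
    S.length γ a b ≤ ENNReal.ofReal (√E * (b - a)) := by
  calc S.length γ a b ≤ ∫⁻ _ in Icc a b, ENNReal.ofReal √E := by
        refine setLIntegral_mono measurable_const fun t ht => ?_
        rw [hγ t ht]
        exact ENNReal.ofReal_le_ofReal (Real.sqrt_le_sqrt ((S.sqNorm_comb_le _ _).trans (hE t ht)))
    _ = _ := by
        rw [setLIntegral_const, Real.volume_Icc, ← ENNReal.ofReal_mul (Real.sqrt_nonneg _)]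

/-- The control of the projection of a Hamiltonian curve. -/
noncomputable def hamControl (S : SubRiemannianStructure n m M) (ξ : CotangentBundle n M) : Eucl m :=
  WithLp.toLp 2 fun i => ξ.2 (S.frame i ξ.1)

theorem sum_hamControl_sq (ξ : CotangentBundle n M) :
    ∑ i, S.hamControl ξ i ^ 2 = 2 * S.hamiltonian ξ := by
  simp [hamControl, hamiltonian]

theorem IsHamAt.continuousAt_hamControl {ξ : ℝ → CotangentBundle n M} {t : ℝ}
    (h : S.IsHamAt ξ t) : ContinuousAt (fun s => S.hamControl (ξ s)) t := by
  obtain ⟨x, hc⟩ : ∃ x, (ξ t).1 ∈ (extChartAt (𝓡 n) x).source := ⟨_, mem_extChartAt_source _⟩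
  have h1 : (fun s => S.hamControl (ξ s)) =ᶠ[𝓝 t] fun s => WithLp.toLp 2 fun i =>
      (cotangentCoord x (ξ s)).2 (S.frameCoord x i (cotangentCoord x (ξ s)).1) := by
    filter_upwards [h.1.eventually ((isOpen_extChartAt_source x).mem_nhds hc)] with s hs
    have := cotangentCoordSymm_cotangentCoord hs
    conv_lhs => rw [← this]
    rfl
  refine ContinuousAt.congr ?_ h1.symm
  have hz := (h.2 x hc).continuousAt
  refine (PiLp.continuous_toLp 2 _).continuousAt.comp (continuousAt_pi.2 fun i => ?_)
  refine ContinuousAt.clm_apply hz.snd ?_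
  exact ContinuousAt.comp (g := S.frameCoord x i)
    (S.differentiableAt_frameCoord (cotangentCoord_fst_mem hc) i).continuousAt hz.fst

/-- A Hamiltonian curve traversed with constant speed `d` projects to a horizontal curve. -/
theorem isHorizontal_of_isHamAt {ξ : ℝ → CotangentBundle n M} {a b r d : ℝ}
    (h : ∀ s ∈ Icc a b, S.IsHamAt ξ (r + d * s)) {E : ℝ}
    (hE : ∀ s ∈ Icc a b, 2 * S.hamiltonian (ξ (r + d * s)) ≤ E) :
    S.IsHorizontal (fun s => (ξ (r + d * s)).1) a b ∧
      S.length (fun s => (ξ (r + d * s)).1) a b ≤ ENNReal.ofReal (√(d ^ 2 * E) * (b - a)) := by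
  have hv : ∀ s ∈ Icc a b, MDifferentiableAt 𝓘(ℝ, ℝ) (𝓡 n) (fun s => (ξ (r + d * s)).1) s ∧
      velocity (fun s => (ξ (r + d * s)).1) s =
        S.comb (ξ (r + d * s)).1 (d • S.hamControl (ξ (r + d * s))) := by
    intro s hs
    obtain ⟨h1, h2⟩ := (h s hs).velocity_eq
    have hl : HasDerivAt (fun s : ℝ => r + d * s) d s := by
      simpa using ((hasDerivAt_id s).const_mul d).const_add r
    have hx := mem_extChartAt_source (I := 𝓡 n) (ξ (r + d * s)).1
    have h3 := hasDerivAt_extChartAt_comp h1 hx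
    refine mdifferentiableAt_of_hasDerivAt (γ := fun s => (ξ (r + d * s)).1)
      (ContinuousAt.comp (g := fun s => (ξ s).1) (h s hs).1 hl.continuousAt) hx ?_
    have h4 := HasDerivAt.scomp s h3 hl
    rw [h2] at h4
    have h5 : S.comb (ξ (r + d * s)).1 (d • S.hamControl (ξ (r + d * s))) =
        d • S.comb (ξ (r + d * s)).1 (S.hamControl (ξ (r + d * s))) := by
      simp [comb, Finset.smul_sum, smul_smul]
    rw [h5, map_smul]
    exact h4
  refine ⟨⟨_, isControlledBy_of_velocity_eq hv fun s hs => ?_⟩,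
    length_le_of_velocity_eq (fun s hs => (hv s hs).2) fun s hs => ?_⟩
  · refine (ContinuousAt.const_smul ?_ d).continuousWithinAt
    exact ContinuousAt.comp (f := fun s : ℝ => r + d * s) (g := fun s => S.hamControl (ξ s))
      (h s hs).continuousAt_hamControl (by fun_prop)
  · simp only [PiLp.smul_apply, smul_eq_mul, mul_pow, ← Finset.mul_sum]
    rw [sum_hamControl_sq]
    exact mul_le_mul_of_nonneg_left (hE s hs) (sq_nonneg d)

end SubRiemannianStructure

end Length

/-! ### Measurability of the speed and reparametrization by arc length. -/

section Speed

variable {n m : ℕ} {M : Type*} [TopologicalSpace M] [ChartedSpace (Eucl n) M]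
  [IsManifold (𝓡 n) ∞ M] {S : SubRiemannianStructure n m M}

namespace SubRiemannianStructure

/-- The squared norm of a horizontal vector is the Legendre transform of the Hamiltonian. -/
theorem two_mul_apply_sub_le_sqNorm {c x : M} (hx : x ∈ (extChartAt (𝓡 n) c).source)
    (u : Eucl m) (η : Eucl n →L[ℝ] ℝ) :
    2 * η (chartDiff c x (S.comb x u)) - 2 * S.hamCoord c (extChartAt (𝓡 n) c x, η) ≤
      S.sqNorm x (S.comb x u) := by
  have h1 := S.apply_chartDiff_comb_le hx η u
  have h2 := Real.sq_sqrt (S.sqNorm_nonneg x (S.comb x u))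
  have h3 := Real.sq_sqrt (show 0 ≤ 2 * S.hamCoord c (extChartAt (𝓡 n) c x, η) by
    have := S.hamCoord_nonneg c (extChartAt (𝓡 n) c x, η); linarith)
  nlinarith [sq_nonneg (√(S.sqNorm x (S.comb x u)) -
    √(2 * S.hamCoord c (extChartAt (𝓡 n) c x, η)))]

/-- Let T send controls to velocities. The projection of u to the range of T* is some T* w and gives
the same vector as u; the covector dual to w then satisfies 2η(Tu) − 2H = |T* w|². -/
theorem exists_sqNorm_le_two_mul_apply_sub {c x : M} (hx : x ∈ (extChartAt (𝓡 n) c).source)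
    (u : Eucl m) : ∃ η : Eucl n →L[ℝ] ℝ, S.sqNorm x (S.comb x u) ≤
      2 * η (chartDiff c x (S.comb x u)) - 2 * S.hamCoord c (extChartAt (𝓡 n) c x, η) := by
  let T : Eucl m →L[ℝ] Eucl n := ∑ i, (EuclideanSpace.proj (𝕜 := ℝ) i).smulRight
    (S.frameCoord c i (extChartAt (𝓡 n) c x))
  have hT : ∀ w, T w = chartDiff c x (S.comb x w) := fun w => by
    rw [S.chartDiff_comb hx]; simp [T]
  have hTe : ∀ i, T (EuclideanSpace.single i 1) = S.frameCoord c i (extChartAt (𝓡 n) c x) := by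
    intro i
    simp [T]
  obtain ⟨y, hy, z, hz, hu⟩ := (LinearMap.range T.adjoint.toLinearMap).exists_add_mem_mem_orthogonal u
  obtain ⟨w, rfl⟩ := hy
  have hTz : T z = 0 := by
    refine ext_inner_right ℝ fun w' => ?_
    rw [inner_zero_left, ← ContinuousLinearMap.adjoint_inner_right]
    exact Submodule.inner_left_of_mem_orthogonal (LinearMap.mem_range_self _ w') hz
  have hTy : T (T.adjoint w) = T u := by
    rw [hu, map_add, hTz, add_zero]; rfl
  have hcomb : S.comb x (T.adjoint w) = S.comb x u :=
    chartDiff_injective hx (by rw [← hT, ← hT, hTy])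
  refine ⟨innerSL ℝ w, ?_⟩
  rw [← hcomb]
  refine (S.sqNorm_comb_le _ _).trans (le_of_eq ?_)
  have h1 : ∀ i, innerSL ℝ w (S.frameCoord c i (extChartAt (𝓡 n) c x)) = T.adjoint w i := by
    intro i
    rw [innerSL_apply_apply, ← hTe, ← ContinuousLinearMap.adjoint_inner_left]
    simp [EuclideanSpace.inner_single_right]
  have h2 : innerSL ℝ w (chartDiff c x (S.comb x (T.adjoint w))) = ∑ i, T.adjoint w i ^ 2 := by
    rw [← hT, innerSL_apply_apply, ← ContinuousLinearMap.adjoint_inner_left,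
      real_inner_self_eq_norm_sq, EuclideanSpace.real_norm_sq_eq]
  rw [h2, hamCoord]
  simp only [h1]
  ring

/-- Continuity in the covector reduces the Legendre transform to a countable supremum. This yields
measurability of the speed although the rank of the frame may vary. -/
theorem ofReal_sqNorm_eq_iSup {c x : M} (hx : x ∈ (extChartAt (𝓡 n) c).source) (u : Eucl m) :
    ENNReal.ofReal (S.sqNorm x (S.comb x u)) = ⨆ k : ℕ, ENNReal.ofReal
      (2 * TopologicalSpace.denseSeq (Eucl n →L[ℝ] ℝ) k (chartDiff c x (S.comb x u)) -
        2 * S.hamCoord c (extChartAt (𝓡 n) c x, TopologicalSpace.denseSeq (Eucl n →L[ℝ] ℝ) k)) := by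
  refine le_antisymm ?_ (iSup_le fun k =>
    ENNReal.ofReal_le_ofReal (two_mul_apply_sub_le_sqNorm hx u _))
  obtain ⟨η, hη⟩ := exists_sqNorm_le_two_mul_apply_sub (S := S) hx u
  refine (ENNReal.ofReal_le_ofReal hη).trans ?_
  let f : (Eucl n →L[ℝ] ℝ) → ℝ≥0∞ := fun η => ENNReal.ofReal
    (2 * η (chartDiff c x (S.comb x u)) - 2 * S.hamCoord c (extChartAt (𝓡 n) c x, η))
  have hf : Continuous f := by
    refine ENNReal.continuous_ofReal.comp ?_
    simp only [hamCoord]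
    fun_prop
  have hcl : IsClosed {η | f η ≤ ⨆ k : ℕ, f (TopologicalSpace.denseSeq (Eucl n →L[ℝ] ℝ) k)} :=
    isClosed_le hf continuous_const
  have hd := TopologicalSpace.denseRange_denseSeq (Eucl n →L[ℝ] ℝ)
  have := hcl.closure_subset_iff.2 (range_subset_iff.2 fun k => le_iSup
    (fun k => f (TopologicalSpace.denseSeq (Eucl n →L[ℝ] ℝ) k)) k)
  exact this (hd η)

/-- The speed of a horizontal curve contained in a chart is integrable. -/
theorem IsHorizontal.integrableOn_speed {γ : ℝ → M} {a b : ℝ} (h : S.IsHorizontal γ a b)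
    {c : M} (hc : MapsTo γ (Icc a b) (extChartAt (𝓡 n) c).source) :
    IntegrableOn (fun t => √(S.sqNorm (γ t) (velocity γ t))) (Icc a b) := by
  obtain ⟨u, h1, h2, h3⟩ := h
  have hq : ContinuousOn (fun t => extChartAt (𝓡 n) c (γ t)) (Icc a b) :=
    (continuousOn_extChartAt c).comp h1.1 hc
  rw [ae_restrict_iff' measurableSet_Icc] at h3
  have hm : AEMeasurable (fun t => ⨆ k : ℕ, ENNReal.ofReal
      (2 * TopologicalSpace.denseSeq (Eucl n →L[ℝ] ℝ) k
        (deriv (fun t => extChartAt (𝓡 n) c (γ t)) t) - 2 * S.hamCoord c (extChartAt (𝓡 n) c (γ t),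
          TopologicalSpace.denseSeq (Eucl n →L[ℝ] ℝ) k))) (volume.restrict (Icc a b)) := by
    refine AEMeasurable.iSup fun k => ENNReal.measurable_ofReal.comp_aemeasurable ?_
    refine AEMeasurable.sub ?_ ?_
    · exact ((ContinuousLinearMap.measurable _).comp (measurable_deriv _)).aemeasurable.const_mul 2
    · refine AEMeasurable.const_mul ?_ 2
      refine ContinuousOn.aemeasurable ?_ measurableSet_Icc
      have h4 : ContinuousOn (S.hamCoord c) ((extChartAt (𝓡 n) c).target ×ˢ univ) :=
        (S.contDiffOn_hamCoord c).continuousOn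
      exact h4.comp (hq.prodMk continuousOn_const)
        fun t ht => ⟨(extChartAt (𝓡 n) c).map_source (hc ht), mem_univ _⟩
  have hm2 : AEMeasurable (fun t => ENNReal.ofReal (S.sqNorm (γ t) (velocity γ t)))
      (volume.restrict (Icc a b)) := by
    refine hm.congr ?_
    rw [Filter.EventuallyEq, ae_restrict_iff' measurableSet_Icc]
    filter_upwards [h3] with t ht hmem
    obtain ⟨h5, h6⟩ := ht hmem
    rw [(hasDerivAt_extChartAt_comp h5 (hc hmem)).deriv, h6, ofReal_sqNorm_eq_iSup (hc hmem)]
  have hm3 : AEStronglyMeasurable (fun t => √(S.sqNorm (γ t) (velocity γ t)))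
      (volume.restrict (Icc a b)) := by
    refine (hm2.ennreal_toReal.sqrt.congr ?_).aestronglyMeasurable
    exact Eventually.of_forall fun t => by
      simp only [ENNReal.toReal_ofReal (S.sqNorm_nonneg _ _)]
  refine Integrable.mono' (h2.norm.integrable (by norm_num)) hm3 ?_
  rw [ae_restrict_iff' measurableSet_Icc]
  filter_upwards [h3] with t ht hmem
  rw [(ht hmem).2, Real.norm_eq_abs, abs_of_nonneg (Real.sqrt_nonneg _), EuclideanSpace.norm_eq]
  refine Real.sqrt_le_sqrt ((S.sqNorm_comb_le _ _).trans (le_of_eq ?_))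
  simp

end SubRiemannianStructure

/-- A change of time that is proportional to the integral of a nonnegative function. -/
theorem exists_time_change {G : ℝ → ℝ} {a b : ℝ} (hab : a < b) (hG0 : ∀ t, 0 ≤ G t)
    (hG : IntegrableOn G (Icc a b)) : ∃ σ σ' : ℝ → ℝ, AbsolutelyContinuousOnInterval σ a b ∧
      MonotoneOn σ (Icc a b) ∧ σ a = a ∧ σ b = b ∧ (∀ᵐ s, s ∈ Icc a b → HasDerivAt σ (σ' s) s) ∧
      (∀ᵐ s, s ∈ Icc a b → 0 ≤ σ' s) ∧
      ∀ᵐ s, s ∈ Icc a b → G s = (∫ t in Icc a b, G t) / (b - a) * σ' s := by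
  have hba : 0 < b - a := sub_pos.2 hab
  have hL0 : 0 ≤ ∫ t in Icc a b, G t := integral_nonneg hG0
  rcases hL0.eq_or_lt with hL | hL
  -- When the integral is zero, G vanishes almost everywhere and the required proportionality has
  -- factor 0, so the identity serves.
  · refine ⟨id, fun _ => 1, ?_, monotone_id.monotoneOn _, rfl, rfl,
      Eventually.of_forall fun s _ => hasDerivAt_id s, Eventually.of_forall fun s _ => zero_le_one, ?_⟩
    · exact LipschitzWith.id.lipschitzOnWith.absolutelyContinuousOnInterval
    · have := (integral_eq_zero_iff_of_nonneg hG0 hG).1 hL.symm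
      rw [Filter.EventuallyEq, ae_restrict_iff' measurableSet_Icc] at this
      filter_upwards [this] with s hs hmem
      simp [hs hmem, ← hL]
  · set L := ∫ t in Icc a b, G t with hLdef
    have hGi : IntervalIntegrable G volume a b :=
      (intervalIntegrable_iff_integrableOn_Icc_of_le hab.le).2 hG
    have hGab : ∫ t in a..b, G t = L := by
      rw [intervalIntegral.integral_of_le hab.le, ← integral_Icc_eq_integral_Ioc]
    have hsub : ∀ {s t}, s ∈ Icc a b → t ∈ Icc a b → IntervalIntegrable G volume s t :=
      fun hs ht => hGi.mono_set (by rw [uIcc_of_le hab.le]; exact uIcc_subset_Icc hs ht)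
    have ha : a ∈ Icc a b := left_mem_Icc.2 hab.le
    refine ⟨fun t => a + (b - a) / L * ∫ s in a..t, G s, fun t => (b - a) / L * G t,
      ?_, ?_, ?_, ?_, ?_, ?_, ?_⟩
    · exact AbsolutelyContinuousOnInterval.fun_add
        (LipschitzWith.const a).lipschitzOnWith.absolutelyContinuousOnInterval
        ((hGi.absolutelyContinuousOnInterval_intervalIntegral left_mem_uIcc).const_mul _)
    · intro s hs t ht hst
      have := intervalIntegral.integral_add_adjacent_intervals (hsub ha hs) (hsub hs ht)
      have h2 : 0 ≤ ∫ r in s..t, G r := intervalIntegral.integral_nonneg hst fun r _ => hG0 r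
      have h3 : 0 ≤ (b - a) / L := by positivity
      simp only [← this]
      nlinarith [mul_nonneg h3 h2]
    · simp
    · simp only [hGab]; field_simp; ring
    · filter_upwards [hGi.ae_hasDerivAt_integral] with s hs hmem
      exact ((hs (by rwa [uIcc_of_le hab.le]) a left_mem_uIcc).const_mul _).const_add _
    · exact Eventually.of_forall fun s _ => mul_nonneg (by positivity) (hG0 s)
    · exact Eventually.of_forall fun s _ => by field_simp

end Speed

/-! ### Uniform local minimality of Hamiltonian curves. -/

section Minimizers

variable {n m : ℕ} {M : Type*} [TopologicalSpace M] [ChartedSpace (Eucl n) M]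
  [IsManifold (𝓡 n) ∞ M] {S : SubRiemannianStructure n m M}

namespace SubRiemannianStructure

theorem exists_closedBall_subset_target (c x : M) (hx : x ∈ (extChartAt (𝓡 n) c).source) :
    ∃ R : ℝ, 0 < R ∧
      Metric.closedBall (extChartAt (𝓡 n) c x) R ⊆ (extChartAt (𝓡 n) c).target :=
  Metric.nhds_basis_closedBall.mem_iff.1
    ((isOpen_extChartAt_target c).mem_nhds ((extChartAt (𝓡 n) c).map_source hx))

theorem exists_bound_frameCoord (S : SubRiemannianStructure n m M) {c : M} {K : Set (Eucl n)}
    (hK : IsCompact K) (hKc : K ⊆ (extChartAt (𝓡 n) c).target) :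
    ∃ B : ℝ, 0 < B ∧ (∀ q ∈ K, ∀ i, ‖S.frameCoord c i q‖ ≤ B) ∧
      ∀ q ∈ K, ∀ i, ‖fderiv ℝ (S.frameCoord c i) q‖ ≤ B := by
  have h1 := fun i => hK.exists_bound_of_continuousOn
    ((S.contDiffOn_frameCoord c i).continuousOn.mono hKc)
  have h2 := fun i => hK.exists_bound_of_continuousOn
    (((S.contDiffOn_frameCoord c i).continuousOn_fderiv_of_isOpen (isOpen_extChartAt_target c)
      (by decide)).mono hKc)
  choose B hB using h1
  choose D hD using h2
  refine ⟨1 + ∑ i, |B i| + ∑ i, |D i|, by positivity, fun q hq i => ?_, fun q hq i => ?_⟩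
  · have := Finset.single_le_sum (f := fun i => |B i|) (fun i _ => abs_nonneg _) (Finset.mem_univ i)
    have h3 : 0 ≤ ∑ i, |D i| := by positivity
    linarith [hB i q hq, le_abs_self (B i)]
  · have := Finset.single_le_sum (f := fun i => |D i|) (fun i _ => abs_nonneg _) (Finset.mem_univ i)
    have h3 : 0 ≤ ∑ i, |B i| := by positivity
    linarith [hD i q hq, le_abs_self (D i)]

theorem apply_frameCoord_sq_le (c : M) (z : PhaseSpace n) (i : Fin m) :
    |z.2 (S.frameCoord c i z.1)| ≤ √(2 * S.hamCoord c z) := by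
  refine Real.abs_le_sqrt ?_
  have : 2 * S.hamCoord c z = ∑ i, (z.2 (S.frameCoord c i z.1)) ^ 2 := by simp [hamCoord]
  rw [this]
  exact Finset.single_le_sum (f := fun i => (z.2 (S.frameCoord c i z.1)) ^ 2)
    (fun i _ => sq_nonneg _) (Finset.mem_univ i)

/-- The momentum satisfies a linear differential inequality. -/
theorem norm_hamField_snd_le {c : M} {z : PhaseSpace n} {B E : ℝ}
    (hB : ∀ i, ‖fderiv ℝ (S.frameCoord c i) z.1‖ ≤ B) (hE : 2 * S.hamCoord c z ≤ E) :
    ‖(S.hamField c z).2‖ ≤ m * √E * B * ‖z.2‖ := by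
  simp only [hamField, norm_neg]
  calc _ ≤ ∑ i, ‖z.2 (S.frameCoord c i z.1) • (z.2 ∘L fderiv ℝ (S.frameCoord c i) z.1)‖ :=
        norm_sum_le _ _
    _ ≤ ∑ _i : Fin m, √E * (‖z.2‖ * B) := by
        refine Finset.sum_le_sum fun i _ => ?_
        rw [norm_smul, Real.norm_eq_abs]
        refine mul_le_mul ((S.apply_frameCoord_sq_le c z i).trans (Real.sqrt_le_sqrt hE)) ?_
          (norm_nonneg _) (Real.sqrt_nonneg _)
        exact (ContinuousLinearMap.opNorm_comp_le _ _).trans (by gcongr; exact hB i)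
    _ = _ := by rw [Finset.sum_const, Finset.card_univ, Fintype.card_fin, nsmul_eq_mul]; ring

/-- Euler's identity for H, which is quadratic in the covector. -/
theorem apply_hamField_fst (c : M) (z : PhaseSpace n) :
    z.2 (S.hamField c z).1 = 2 * S.hamCoord c z := by
  simp [hamField, hamCoord, pow_two]

theorem two_mul_hamCoord_le {c : M} {z : PhaseSpace n} {B P : ℝ}
    (hB : ∀ i, ‖S.frameCoord c i z.1‖ ≤ B) (hP : ‖z.2‖ ≤ P) :
    2 * S.hamCoord c z ≤ m * (P * B) ^ 2 := by
  have : 2 * S.hamCoord c z = ∑ i, (z.2 (S.frameCoord c i z.1)) ^ 2 := by simp [hamCoord]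
  rw [this]
  calc _ ≤ ∑ _i : Fin m, (P * B) ^ 2 := by
        refine Finset.sum_le_sum fun i _ => ?_
        rw [← sq_abs]
        have h1 := z.2.le_opNorm (S.frameCoord c i z.1)
        have h2 : ‖z.2‖ * ‖S.frameCoord c i z.1‖ ≤ P * B :=
          mul_le_mul hP (hB i) (norm_nonneg _) ((norm_nonneg _).trans hP)
        exact pow_le_pow_left₀ (abs_nonneg _) (h1.trans h2) 2
    _ = _ := by rw [Finset.sum_const, Finset.card_univ, Fintype.card_fin, nsmul_eq_mul]

/-- The residual of the Hamilton-Jacobi equation for the calibrating function. -/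
theorem residual_le {c : M} {z : PhaseSpace n} (hz : z.1 ∈ (extChartAt (𝓡 n) c).target)
    {x : Eucl n} {s C κ : ℝ} {η : Eucl n →L[ℝ] ℝ} (hη : η = z.2 - (κ * s) • innerSL ℝ (x - z.1))
    (hC : |S.hamCoord c (x, η) - S.hamCoord c z - fderiv ℝ (S.hamCoord c) z ((x, η) - z)| ≤
      C * ‖(x, η) - z‖ ^ 2) (hC0 : 0 ≤ C) (hκ : κ = 2 * C + 2) (hs : κ * |s| ≤ 1) :
    S.hamCoord c z + (S.hamField c z).2 (x - z.1) - η (S.hamField c z).1 -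
      κ / 2 * ‖x - z.1‖ ^ 2 + S.hamCoord c (x, η) ≤ -‖x - z.1‖ ^ 2 := by
  have hκ0 : 0 ≤ κ := by linarith
  have h1 : (x, η) - z = (x - z.1, -((κ * s) • innerSL ℝ (x - z.1))) := by
    refine Prod.ext rfl ?_
    simp [hη]
  -- The product carries the sup norm, and κ|s| ≤ 1 makes the momentum shift at most the position
  -- shift; the remainder is thus quadratic in x − z.1 alone.
  have h2 : ‖(x, η) - z‖ ≤ ‖x - z.1‖ := by
    rw [h1, Prod.norm_def]
    refine max_le le_rfl ?_
    rw [norm_neg, norm_smul, innerSL_apply_norm, Real.norm_eq_abs, abs_mul, abs_of_nonneg hκ0]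
    exact mul_le_of_le_one_left (norm_nonneg _) hs
  have h3 : C * ‖(x, η) - z‖ ^ 2 ≤ C * ‖x - z.1‖ ^ 2 := by gcongr
  have h4 := (le_abs_self _).trans (hC.trans h3)
  rw [S.fderiv_hamCoord_apply hz, symplecticForm, h1] at h4
  have h5 : η (S.hamField c z).1 = 2 * S.hamCoord c z -
      κ * s * innerSL ℝ (x - z.1) (S.hamField c z).1 := by
    rw [← S.apply_hamField_fst c z, hη]; rfl
  have h6 : (-((κ * s) • innerSL ℝ (x - z.1))) (S.hamField c z).1 =
      -(κ * s * innerSL ℝ (x - z.1) (S.hamField c z).1) := rfl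
  simp only [h6] at h4
  rw [h5]
  -- κ/2 = C + 1: C absorbs the Taylor remainder and 1 is the margin used for uniqueness.
  have h7 : κ / 2 * ‖x - z.1‖ ^ 2 = C * ‖x - z.1‖ ^ 2 + ‖x - z.1‖ ^ 2 := by rw [hκ]; ring
  linarith

/-- The constants of the local minimality theorem. -/
theorem isUniqueLengthMinimizer_of_bounds [T2Space M] {x : M} {R B E P C κ ε : ℝ} (hR0 : 0 < R)
    (hR : Metric.closedBall (extChartAt (𝓡 n) x x) R ⊆ (extChartAt (𝓡 n) x).target)
    (hB0 : 0 < B)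
    (hB : ∀ q ∈ Metric.closedBall (extChartAt (𝓡 n) x x) R, ∀ i, ‖S.frameCoord x i q‖ ≤ B)
    (hB' : ∀ q ∈ Metric.closedBall (extChartAt (𝓡 n) x x) R, ∀ i,
      ‖fderiv ℝ (S.frameCoord x i) q‖ ≤ B)
    (hC0 : 0 ≤ C) (hκ : κ = 2 * C + 2) {W : Set (PhaseSpace n)}
    (hW : W = Metric.closedBall (extChartAt (𝓡 n) x x) R ×ˢ Metric.closedBall 0 (2 * P + 2 * R))
    (hC : ∀ z ∈ W, ∀ w ∈ W, |S.hamCoord x w - S.hamCoord x z -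
      fderiv ℝ (S.hamCoord x) z (w - z)| ≤ C * ‖w - z‖ ^ 2)
    (hε0 : 0 < ε) (hε1 : m * B * (√E * (2 * ε)) < R / 4) (hε2 : 2 * ε * (m * √E * B) ≤ 1 / 2)
    (hε3 : κ * ε ≤ 1) {ζ : ℝ → CotangentBundle n M} {t₀ : ℝ} (hζ : ∀ t, S.IsHamAt ζ t)
    (hζx : (ζ t₀).1 = x) (hζE : 2 * S.hamiltonian (ζ t₀) ≤ E)
    (hζP : ‖(cotangentCoord x (ζ t₀)).2‖ ≤ P) :
    S.IsUniqueLengthMinimizer (fun s => (ζ s).1) (t₀ - ε) (t₀ + ε) := by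
  have hab : t₀ - ε < t₀ + ε := by linarith
  set I : Set ℝ := Icc (t₀ - ε) (t₀ + ε) with hI
  have ht₀ : t₀ ∈ I := ⟨by linarith, by linarith⟩
  set h : ℝ := S.hamiltonian (ζ t₀) with hh
  have hham : ∀ t, S.hamiltonian (ζ t) = h := fun t =>
    hamiltonian_eq_of_isHamAt convex_univ (fun t _ => hζ t) (mem_univ t) (mem_univ t₀)
  obtain ⟨hhor, hlen⟩ : S.IsHorizontal (fun s => (ζ s).1) (t₀ - ε) (t₀ + ε) ∧
      S.length (fun s => (ζ s).1) (t₀ - ε) (t₀ + ε) ≤ ENNReal.ofReal (√(2 * h) * (2 * ε)) := by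
    have := isHorizontal_of_isHamAt (S := S) (ξ := ζ) (a := t₀ - ε) (b := t₀ + ε) (r := 0) (d := 1)
      (E := 2 * h) (fun s _ => hζ _) (fun s _ => by rw [hham])
    simp only [zero_add, one_mul, one_pow] at this
    rwa [show t₀ + ε - (t₀ - ε) = 2 * ε by ring] at this
  have hlenE : √(2 * h) * (2 * ε) ≤ √E * (2 * ε) := by gcongr
  refine ⟨hhor, fun c hc hca hcb => ?_⟩
  set ℓ : ℝ := √E * (2 * ε) with hℓ
  have hℓ0 : 0 ≤ ℓ := by positivity
  have hx := mem_extChartAt_source (I := 𝓡 n) x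
  have hγchart := hhor.mem_chart_of_length_le (c := x) (r := 0) hR hB0.le hℓ0 hB
    (hlen.trans (ENNReal.ofReal_le_ofReal hlenE)) ht₀ (by simp only [hζx]; exact hx)
    (by simp only [hζx]; rw [dist_self]) (by linarith)
  simp only [hζx] at hγchart
  -- A competitor longer than ℓ is strictly longer than γ; any other one is confined to the chart.
  rcases lt_or_ge (ENNReal.ofReal ℓ) (S.length c (t₀ - ε) (t₀ + ε)) with hcl | hcl
  · have h1 := (hlen.trans (ENNReal.ofReal_le_ofReal hlenE)).trans_lt hcl
    exact ⟨h1.le, fun he => absurd he h1.ne'⟩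
  have haI : t₀ - ε ∈ I := left_mem_Icc.2 hab.le
  have hbI : t₀ + ε ∈ I := right_mem_Icc.2 hab.le
  have hcchart := hc.mem_chart_of_length_le (c := x) (r := R / 4) hR hB0.le hℓ0 hB
    hcl haI (by rw [hca]; exact (hγchart _ haI).1)
    (by rw [hca]; exact (hγchart _ haI).2.trans hε1.le) (by linarith)
  -- Each curve moves by less than R/4 from a known point: γ from q₀, and c from the initial point
  -- of γ. So γ stays within R/4 of q₀, c within R/2, and they remain at distance at most R.
  set q₀ := extChartAt (𝓡 n) x x with hq₀
  have hγd : ∀ t ∈ I, dist (extChartAt (𝓡 n) x (ζ t).1) q₀ ≤ R / 4 := fun t ht =>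
    (hγchart t ht).2.trans hε1.le
  have hcd : ∀ t ∈ I, dist (extChartAt (𝓡 n) x (c t)) q₀ ≤ R / 2 := fun t ht => by
    have h1 := (hcchart t ht).2
    rw [hca] at h1
    linarith [dist_triangle (extChartAt (𝓡 n) x (c t)) (extChartAt (𝓡 n) x (ζ (t₀ - ε)).1) q₀,
      hγd _ haI]
  have hz : ∀ t ∈ I, HasDerivAt (fun s => cotangentCoord x (ζ s))
      (S.hamField x (cotangentCoord x (ζ t))) t := fun t ht => (hζ t).2 x (hγchart t ht).1
  have hz1 : ∀ t ∈ I, HasDerivAt (fun s => (cotangentCoord x (ζ s)).1)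
      (S.hamField x (cotangentCoord x (ζ t))).1 t := fun t ht => (hz t ht).fst
  have hz2 : ∀ t ∈ I, HasDerivAt (fun s => (cotangentCoord x (ζ s)).2)
      (S.hamField x (cotangentCoord x (ζ t))).2 t := fun t ht => (hz t ht).snd
  have hzR : ∀ t ∈ I, (cotangentCoord x (ζ t)).1 ∈ Metric.closedBall q₀ R := fun t ht =>
    (hγd t ht).trans (by linarith)
  have hzh : ∀ t ∈ I, S.hamCoord x (cotangentCoord x (ζ t)) = h := fun t ht => by
    rw [S.hamCoord_cotangentCoord (hγchart t ht).1, hham]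
  have hpP : ∀ t ∈ I, ‖(cotangentCoord x (ζ t)).2‖ ≤ 2 * P := fun t ht => by
    have := norm_le_two_mul_of_norm_deriv_le (L := m * √E * B)
      (fun t ht => (hz2 t ht).hasDerivWithinAt)
      (fun t ht => S.norm_hamField_snd_le (hB' _ (hzR t ht)) (by rw [hzh t ht]; exact hζE))
      (by positivity) (by rwa [show t₀ + ε - (t₀ - ε) = 2 * ε by ring]) ht₀ ht
    linarith
  have hzt : ∀ t ∈ I, (cotangentCoord x (ζ t)).1 ∈ (extChartAt (𝓡 n) x).target := fun t ht =>
    hR (hzR t ht)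
  have hzc : ContinuousOn (fun s => cotangentCoord x (ζ s)) I := fun t ht =>
    (hz t ht).continuousAt.continuousWithinAt
  have hFc : ContinuousOn (fun s => S.hamField x (cotangentCoord x (ζ s))) I :=
    (S.contDiffOn_hamField x).continuousOn.comp hzc fun t ht => ⟨hzt t ht, mem_univ _⟩
  obtain ⟨D, hD⟩ := isCompact_Icc.exists_bound_of_continuousOn hFc
  have hLγ : LipschitzOnWith D.toNNReal (fun s => (cotangentCoord x (ζ s)).1) I :=
    (convex_Icc _ _).lipschitzOnWith_of_nnnorm_hasDerivWithin_le
      (fun t ht => (hz1 t ht).hasDerivWithinAt) fun t ht => by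
        rw [← NNReal.coe_le_coe, coe_nnnorm]
        exact (norm_fst_le _).trans ((hD t ht).trans (Real.le_coe_toNNReal D))
  have hLp : LipschitzOnWith D.toNNReal (fun s => (cotangentCoord x (ζ s)).2) I :=
    (convex_Icc _ _).lipschitzOnWith_of_nnnorm_hasDerivWithin_le
      (fun t ht => (hz2 t ht).hasDerivWithinAt) fun t ht => by
        rw [← NNReal.coe_le_coe, coe_nnnorm]
        exact (norm_snd_le _).trans ((hD t ht).trans (Real.le_coe_toNNReal D))
  have hcm : MapsTo c I (extChartAt (𝓡 n) x).source := fun t ht => (hcchart t ht).1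
  obtain ⟨σ, σ', hσAC, hσm, hσa, hσb, hσ', hσ0, hσG⟩ := exists_time_change hab
    (fun t => Real.sqrt_nonneg (S.sqNorm (c t) (velocity c t))) (hc.integrableOn_speed hcm)
  have hσI : MapsTo σ I I := fun t ht =>
    ⟨by rw [← hσa]; exact hσm haI ht ht.1, by rw [← hσb]; exact hσm ht hbI ht.2⟩
  have hclen : S.length c (t₀ - ε) (t₀ + ε) =
      ENNReal.ofReal (∫ t in I, √(S.sqNorm (c t) (velocity c t))) := by
    rw [ofReal_integral_eq_lintegral_ofReal (hc.integrableOn_speed hcm)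
      (Eventually.of_forall fun t => Real.sqrt_nonneg _)]
    rfl
  have hLn : 0 ≤ ∫ t in I, √(S.sqNorm (c t) (velocity c t)) :=
    integral_nonneg fun t => Real.sqrt_nonneg _
  set L := ∫ t in I, √(S.sqNorm (c t) (velocity c t)) with hL
  rw [show t₀ + ε - (t₀ - ε) = 2 * ε by ring] at hσG
  obtain ⟨u, hcAC, -, hcu⟩ := hc
  rw [ae_restrict_iff' measurableSet_Icc] at hcu
  have key := calibration (H := fun q η => S.hamCoord x (q, η)) (K := κ) (h := h)
    (v := L / (2 * ε)) (t₀ := t₀) (fun q η => S.hamCoord_nonneg x _) hε0 hI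
    hz1 hz2 hLγ hLp
    (c := fun t => extChartAt (𝓡 n) x (c t)) (c' := fun t => chartDiff x (c t) (velocity c t))
    (hcAC.2 _ _ x le_rfl hab.le le_rfl (by rwa [extChartAt_source] at hcm)) hσAC hσI hσa hσb
    ?_ hσ' hσ0 ?_ ?_ (by simp only [hca]; rfl) (by simp only [hcb]; rfl)
  · obtain ⟨k1, k2⟩ := key
    -- For γ the upper bound √(2h) 2ε on its length is enough, since every competitor that stays in
    -- the chart is at least that long.
    have k3 : √(2 * h) * (2 * ε) ≤ L := by
      rw [← le_div_iff₀ (by positivity)]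
      exact Real.sqrt_le_left (by positivity) |>.2 (by linarith)
    refine ⟨?_, fun heq => ?_⟩
    · rw [hclen]; exact hlen.trans (ENNReal.ofReal_le_ofReal k3)
    · have k4 : L ≤ √(2 * h) * (2 * ε) := by
        rw [← ENNReal.ofReal_le_ofReal_iff (by positivity), ← hclen, heq]
        exact hlen
      rw [← div_le_iff₀ (by positivity)] at k4
      have k5 : (L / (2 * ε)) ^ 2 / 2 ≤ h := by
        have h0 : 0 ≤ h := by rw [hh]; unfold hamiltonian; positivity
        have := pow_le_pow_left₀ (by positivity) k4 2
        rw [Real.sq_sqrt (by positivity)] at this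
        linarith
      refine ⟨σ, by simpa only [uIcc_of_le hab.le] using hσAC.continuousOn, hσm, hσa, hσb,
        fun t ht => ?_⟩
      exact (extChartAt (𝓡 n) x).injOn (hcm ht) (hγchart _ (hσI ht)).1 (k2 k5 t ht)
  · filter_upwards [hcu] with t ht hmem
    exact hasDerivAt_extChartAt_comp (ht hmem).1 (hcm hmem)
  · filter_upwards [hcu, hσG] with t ht hG hmem η
    have h1 := S.apply_chartDiff_comb_le (hcm hmem) η (u t)
    rwa [← (ht hmem).2, hG hmem] at h1
  · intro s hs τ hτ η hη
    have hdist : ‖extChartAt (𝓡 n) x (c s) - (cotangentCoord x (ζ τ)).1‖ ≤ R := by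
      rw [← dist_eq_norm]
      have := dist_triangle_right (extChartAt (𝓡 n) x (c s)) (cotangentCoord x (ζ τ)).1 q₀
      have h2 : dist (cotangentCoord x (ζ τ)).1 q₀ ≤ R / 4 := hγd τ hτ
      linarith [hcd s hs]
    have hκ0 : 0 ≤ κ := by linarith
    have hκτ : κ * |τ - t₀| ≤ 1 := by
      refine (mul_le_mul_of_nonneg_left ?_ hκ0).trans hε3
      rw [abs_le]; constructor <;> linarith [hτ.1, hτ.2]
    -- The momentum of the curve contributes 2P, and the correction at most R.
    have hηP : ‖η‖ ≤ 2 * P + 2 * R := by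
      rw [hη]
      refine (norm_sub_le _ _).trans ?_
      rw [norm_smul, innerSL_apply_norm, Real.norm_eq_abs, abs_mul, abs_of_nonneg hκ0]
      have := mul_le_mul hκτ hdist (norm_nonneg _) zero_le_one
      linarith [hpP τ hτ]
    have hzW : cotangentCoord x (ζ τ) ∈ W := by
      rw [hW]
      refine ⟨hzR τ hτ, ?_⟩
      rw [Metric.mem_closedBall, dist_zero_right]
      linarith [hpP τ hτ]
    have hwW : ((extChartAt (𝓡 n) x (c s), η) : PhaseSpace n) ∈ W := by
      rw [hW]
      refine ⟨(hcd s hs).trans (by linarith), ?_⟩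
      rwa [Metric.mem_closedBall, dist_zero_right]
    have := residual_le (hzt τ hτ) hη (hC _ hzW _ hwW) hC0 hκ hκτ
    rwa [hzh τ hτ] at this

/-- Hamiltonian curves issuing from a compact set of covectors are uniformly locally minimizing. -/
theorem exists_isUniqueLengthMinimizer [T2Space M] (S : SubRiemannianStructure n m M) (x : M)
    {Λ : Set (Cotangent n x)} (hΛ : IsCompact Λ) :
    ∃ ε₀ : ℝ, 0 < ε₀ ∧ ∀ ε, 0 < ε → ε ≤ ε₀ → ∀ (ζ : ℝ → CotangentBundle n M) (t₀ : ℝ),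
      (∀ t, S.IsHamAt ζ t) → (∃ p ∈ Λ, ζ t₀ = ⟨x, p⟩) →
        S.IsUniqueLengthMinimizer (fun s => (ζ s).1) (t₀ - ε) (t₀ + ε) := by
  have hx := mem_extChartAt_source (I := 𝓡 n) x
  obtain ⟨R, hR0, hR⟩ := exists_closedBall_subset_target x x hx
  obtain ⟨B, hB0, hB, hB'⟩ := S.exists_bound_frameCoord (isCompact_closedBall _ R) hR
  obtain ⟨P, hP⟩ : ∃ P : ℝ, ∀ p ∈ Λ, ‖(cotangentCoord x ⟨x, p⟩).2‖ ≤ P := by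
    have hcont : Continuous fun p : Cotangent n x => (cotangentCoord x ⟨x, p⟩).2 :=
      ContinuousLinearMap.continuous (ContinuousLinearMap.precomp (σ := RingHom.id ℝ) (τ := RingHom.id ℝ) ℝ (chartDiff (n := n) x x).inverse)
    obtain ⟨P, hP⟩ := (hΛ.image hcont).isBounded.exists_norm_le
    exact ⟨P, fun p hp => hP _ (mem_image_of_mem _ hp)⟩
  set W : Set (PhaseSpace n) := Metric.closedBall (extChartAt (𝓡 n) x x) R ×ˢ
    Metric.closedBall 0 (2 * P + 2 * R) with hW
  obtain ⟨C, hC0, hC⟩ := exists_taylor_remainder_le (isOpen_phaseDomain x)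
    ((S.contDiffOn_hamCoord x).of_le (by decide))
    (K := W) ((isCompact_closedBall _ _).prod (isCompact_closedBall _ _))
    ((convex_closedBall _ _).prod (convex_closedBall _ _)) (prod_mono hR (subset_univ _))
  set E : ℝ := m * (P * B) ^ 2 with hE
  -- All three conditions persist for smaller ε. The conclusion for every ε ≤ ε₀ allows the interval
  -- to be shrunk into [0, 1] later.
  have hlim : ∀ᶠ ε : ℝ in 𝓝[>] 0, (m * B * (√E * (2 * ε)) < R / 4 ∧
      2 * ε * (m * √E * B) ≤ 1 / 2 ∧ (2 * C + 2) * ε ≤ 1) := by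
    refine nhdsWithin_le_nhds ?_
    have e1 : Tendsto (fun ε : ℝ => m * B * (√E * (2 * ε))) (𝓝 0) (𝓝 (m * B * (√E * (2 * 0)))) :=
      (Continuous.tendsto (by fun_prop) 0)
    have e2 : Tendsto (fun ε : ℝ => 2 * ε * (m * √E * B)) (𝓝 0) (𝓝 (2 * 0 * (m * √E * B))) :=
      (Continuous.tendsto (by fun_prop) 0)
    have e3 : Tendsto (fun ε : ℝ => (2 * C + 2) * ε) (𝓝 0) (𝓝 ((2 * C + 2) * 0)) :=
      (Continuous.tendsto (by fun_prop) 0)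
    filter_upwards [e1.eventually_lt_const (u := R / 4) (by simpa using hR0),
      e2.eventually_lt_const (u := 1 / 2) (by norm_num),
      e3.eventually_lt_const (u := 1) (by norm_num)] with ε h1 h2 h3
    exact ⟨h1, h2.le, h3.le⟩
  obtain ⟨ε₀, hε₀, hsub⟩ := (mem_nhdsGT_iff_exists_Ioc_subset (a := (0 : ℝ))).1 hlim
  refine ⟨ε₀, hε₀, fun ε h0 h1 ζ t₀ hζ ⟨p, hp, hζp⟩ => ?_⟩
  obtain ⟨k1, k2, k3⟩ := hsub ⟨h0, h1⟩
  have hPp : ‖(cotangentCoord x (ζ t₀)).2‖ ≤ P := by rw [hζp]; exact hP p hp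
  refine isUniqueLengthMinimizer_of_bounds hR0 hR hB0 hB hB' hC0 rfl hW hC h0 k1 k2 k3 hζ
    (by rw [hζp]) ?_ hPp
  rw [← S.hamCoord_cotangentCoord (c := x) (by rw [hζp]; exact hx)]
  refine S.two_mul_hamCoord_le (fun i => hB _ ?_ i) hPp
  rw [hζp]
  exact Metric.mem_closedBall_self hR0.le

end SubRiemannianStructure

end Minimizers

/-! ### Open intervals near a missing endpoint, treated without distinguishing left from right. -/

section Intervals

theorem Ioo_min_max_subset {I : Set ℝ} (hI : IsOpen I) (hconv : Convex ℝ I) {s t : ℝ} (hs : s ∈ I)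
    (ht : t ∈ closure I) : Ioo (min s t) (max s t) ⊆ I := by
  rcases eq_or_ne s t with h | h
  · simp [h]
  have := hconv.openSegment_interior_closure_subset_interior (by rwa [hI.interior_eq]) ht
  rwa [openSegment_eq_Ioo' h, hI.interior_eq] at this

/-- Such a t lies beyond the endpoint b of I, so near t a curve glued at b coincides with the new
piece. -/
theorem notMem_closure_of_dist_lt {I : Set ℝ} (hI : IsOpen I) (hconv : Convex ℝ I) {s b t : ℝ}
    (hs : s ∈ I) (hb : b ∈ closure I) (hbI : b ∉ I) (ht : |t - b| < |s - b|) (htI : t ∉ I)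
    (htb : t ≠ b) : t ∉ closure I := by
  intro htc
  have h1 : b ∉ Ioo (min s t) (max s t) := fun h => hbI (Ioo_min_max_subset hI hconv hs htc h)
  have h2 : t ∉ Ioo (min s b) (max s b) := fun h => htI (Ioo_min_max_subset hI hconv hs hb h)
  have h3 : s ≠ b := fun h => hbI (h ▸ hs)
  have h4 : s ≠ t := fun h => htI (h ▸ hs)
  simp only [mem_Ioo, min_lt_iff, lt_max_iff, not_and_or, not_or, not_lt] at h1 h2
  rcases lt_or_gt_of_ne h3 with h | h <;> rcases lt_or_gt_of_ne htb with h' | h' <;>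
    rcases lt_or_gt_of_ne h4 with h'' | h'' <;>
    first
    | (rw [abs_of_neg (sub_neg.2 h), abs_of_neg (sub_neg.2 h')] at ht; grind)
    | (rw [abs_of_neg (sub_neg.2 h), abs_of_pos (sub_pos.2 h')] at ht; grind)
    | (rw [abs_of_pos (sub_pos.2 h), abs_of_neg (sub_neg.2 h')] at ht; grind)
    | (rw [abs_of_pos (sub_pos.2 h), abs_of_pos (sub_pos.2 h')] at ht; grind)

/-- Near its endpoint b, I lies on one side only, between s and b. -/
theorem mem_Ioo_min_max_of_dist_lt {I : Set ℝ} (hI : IsOpen I) (hconv : Convex ℝ I) {s b t : ℝ}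
    (hs : s ∈ I) (hbI : b ∉ I) (ht : |t - b| < |s - b|) (htI : t ∈ I) :
    t ∈ Ioo (min s b) (max s b) := by
  have h1 : b ∉ Ioo (min s t) (max s t) := fun h =>
    hbI (Ioo_min_max_subset hI hconv hs (subset_closure htI) h)
  have h3 : s ≠ b := fun h => hbI (h ▸ hs)
  have h4 : t ≠ b := fun h => hbI (h ▸ htI)
  simp only [mem_Ioo, min_lt_iff, lt_max_iff, not_and_or, not_or, not_lt] at h1 ⊢
  rcases lt_or_gt_of_ne h3 with h | h <;> rcases lt_or_gt_of_ne h4 with h' | h' <;>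
    first
    | (rw [abs_of_neg (sub_neg.2 h), abs_of_neg (sub_neg.2 h')] at ht; grind)
    | (rw [abs_of_neg (sub_neg.2 h), abs_of_pos (sub_pos.2 h')] at ht; grind)
    | (rw [abs_of_pos (sub_pos.2 h), abs_of_neg (sub_neg.2 h')] at ht; grind)
    | (rw [abs_of_pos (sub_pos.2 h), abs_of_pos (sub_pos.2 h')] at ht; grind)

theorem hasDerivWithinAt_closure_of_tendsto {F : Type*} [NormedAddCommGroup F] [NormedSpace ℝ F]
    {Z Z' : ℝ → F} {J : Set ℝ} {b : ℝ} {v : F} (hJ : IsOpen J) (hconv : Convex ℝ J)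
    (hZ : ∀ s ∈ J, HasDerivAt Z (Z' s) s) (hc : ∀ y ∈ closure J, ContinuousWithinAt Z J y)
    (hv : Tendsto Z' (𝓝[J] b) (𝓝 v)) : HasDerivWithinAt Z v (closure J) b := by
  refine hasFDerivWithinAt_closure_of_tendsto_fderiv
    (fun s hs => (hZ s hs).differentiableAt.differentiableWithinAt) hconv hJ hc ?_
  have h1 := ((ContinuousLinearMap.toSpanSingletonCLE (𝕜 := ℝ) (E := F)).continuous.tendsto v).comp hv
  refine h1.congr' ?_
  filter_upwards [self_mem_nhdsWithin] with s hs
  exact (hZ s hs).hasFDerivAt.fderiv.symm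

end Intervals

/-! ### Limits of Hamiltonian curves at the ends of their domain, and local existence. -/

section Completeness

variable {n m : ℕ} {M : Type*} [TopologicalSpace M] [ChartedSpace (Eucl n) M]
  [IsManifold (𝓡 n) ∞ M] {S : SubRiemannianStructure n m M}

namespace SubRiemannianStructure

theorem distSR_le_of_isHamAt {ξ : ℝ → CotangentBundle n M} {I : Set ℝ} (hI : Convex ℝ I)
    (h : ∀ t ∈ I, S.IsHamAt ξ t) {E : ℝ} (hE : ∀ t ∈ I, 2 * S.hamiltonian (ξ t) ≤ E) {s t : ℝ}
    (hs : s ∈ I) (ht : t ∈ I) : S.IsHorizontal (fun r => (ξ (s + (t - s) * r)).1) 0 1 ∧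
      S.length (fun r => (ξ (s + (t - s) * r)).1) 0 1 ≤ ENNReal.ofReal (√E * |t - s|) := by
  have hmem : ∀ r ∈ Icc (0 : ℝ) 1, s + (t - s) * r ∈ I := fun r hr => by
    have := hI.add_smul_sub_mem hs ht hr
    rwa [smul_eq_mul, mul_comm] at this
  have := isHorizontal_of_isHamAt (S := S) (ξ := ξ) (a := 0) (b := 1) (r := s) (d := t - s)
    (E := E) (fun r hr => h _ (hmem r hr)) (fun r hr => hE _ (hmem r hr))
  rwa [Real.sqrt_mul (sq_nonneg _), Real.sqrt_sq_eq_abs, sub_zero, mul_one, mul_comm |t - s|] at this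

/-- In a complete sub-Riemannian manifold the projection of a Hamiltonian curve converges at the
extremities of its interval of definition. -/
theorem exists_tendsto_fst_of_isHamAt [T2Space M] (hS : S.IsCompleteSR)
    {ξ : ℝ → CotangentBundle n M} {I : Set ℝ} (hI : Convex ℝ I) (h : ∀ t ∈ I, S.IsHamAt ξ t)
    {b : ℝ} (hb : b ∈ closure I) : ∃ y : M, Tendsto (fun t => (ξ t).1) (𝓝[I] b) (𝓝 y) := by
  obtain ⟨τ, hτI, hτb⟩ := mem_closure_iff_seq_limit.1 hb
  set E : ℝ := 2 * S.hamiltonian (ξ (τ 0)) with hE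
  have hE' : ∀ t ∈ I, 2 * S.hamiltonian (ξ t) ≤ E := fun t ht => by
    rw [hE, hamiltonian_eq_of_isHamAt hI h ht (hτI 0)]
  have hcurve := fun {s t} hs ht => distSR_le_of_isHamAt hI h hE' (s := s) (t := t) hs ht
  have hdist : ∀ s ∈ I, ∀ t ∈ I, S.distSR (ξ s).1 (ξ t).1 ≤ ENNReal.ofReal (√E * |t - s|) :=
    fun s hs t ht => (iInf₂_le _ ⟨(hcurve hs ht).1, by simp, by simp⟩).trans (hcurve hs ht).2
  obtain ⟨y, hy⟩ := hS (fun k => (ξ (τ k)).1) fun ε hε => by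
    have h1 : Tendsto (fun p : ℕ × ℕ => ENNReal.ofReal (√E * |τ p.2 - τ p.1|)) (atTop ×ˢ atTop)
        (𝓝 (ENNReal.ofReal (√E * |b - b|))) :=
      ENNReal.tendsto_ofReal ((((hτb.comp tendsto_snd).sub (hτb.comp tendsto_fst)).abs).const_mul _)
    rw [sub_self, abs_zero, mul_zero, ENNReal.ofReal_zero] at h1
    obtain ⟨N, hN⟩ := (eventually_atTop_prod_self'.1 (prod_atTop_atTop_eq (α := ℕ) (β := ℕ) ▸
      h1.eventually_lt_const hε))
    exact ⟨N, fun i hi j hj => (hdist _ (hτI i) _ (hτI j)).trans_lt (hN i hi j hj)⟩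
  -- Completeness gives a limit for the distance only. Convergence in the topology of M follows
  -- because short horizontal curves meeting a small chart ball around y remain near y.
  refine ⟨y, fun V hV => ?_⟩
  have hyc := mem_extChartAt_source (I := 𝓡 n) y
  obtain ⟨R, hR0, hR⟩ := exists_closedBall_subset_target y y hyc
  obtain ⟨B, hB0, hB, -⟩ := S.exists_bound_frameCoord (isCompact_closedBall _ R) hR
  obtain ⟨ρ', hρ'0, hρ'⟩ : ∃ ρ' > 0, ∀ x ∈ (extChartAt (𝓡 n) y).source,
      dist (extChartAt (𝓡 n) y x) (extChartAt (𝓡 n) y y) < ρ' → x ∈ V := by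
    have h1 : (extChartAt (𝓡 n) y).symm ⁻¹' V ∈ 𝓝 (extChartAt (𝓡 n) y y) :=
      (continuousAt_extChartAt_symm y).preimage_mem_nhds (by rwa [extChartAt_to_inv])
    obtain ⟨ρ', h2, h3⟩ := Metric.mem_nhds_iff.1 h1
    refine ⟨ρ', h2, fun x hx hd => ?_⟩
    have := h3 (Metric.mem_ball.2 hd)
    rwa [mem_preimage, (extChartAt (𝓡 n) y).left_inv hx] at this
  set ρ := min R ρ' with hρ
  have hρ0 : 0 < ρ := lt_min hR0 hρ'0
  -- Two successive curves of length at most ℓ are used, from y to the curve at `τ k` and from there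
  -- to the curve at t; each moves by less than ρ/2.
  set ℓ : ℝ := ρ / (4 * (m * B + 1)) with hℓ
  have hℓ0 : 0 < ℓ := by positivity
  have hmℓ : m * B * ℓ < ρ / 2 := by
    have h1 : (m * B + 1) * ℓ = ρ / 4 := by rw [hℓ]; field_simp
    nlinarith
  have hτb' : Tendsto (fun k => √E * |τ k - b|) atTop (𝓝 0) := by
    simpa using ((hτb.sub_const b).abs).const_mul √E
  obtain ⟨k, hk1, hk2⟩ := ((hy.eventually_lt_const (ENNReal.ofReal_pos.2 hℓ0)).and
    (hτb'.eventually_lt_const (half_pos hℓ0))).exists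
  obtain ⟨γ, hγ⟩ := iInf_lt_iff.1 hk1
  obtain ⟨⟨hγh, hγ0, hγ1⟩, hγℓ⟩ := iInf_lt_iff.1 hγ
  have hx := hγh.mem_chart_of_length_le (c := y) (r := 0) hR hB0.le hℓ0.le hB hγℓ.le
    (right_mem_Icc.2 zero_le_one) (by rwa [hγ1]) (by rw [hγ1, dist_self])
    (by linarith [min_le_left R ρ']) 0 (left_mem_Icc.2 zero_le_one)
  rw [hγ0, hγ1] at hx
  have hev : ∀ᶠ t in 𝓝[I] b, √E * |t - b| < ℓ / 2 := by
    refine nhdsWithin_le_nhds ?_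
    have e1 : Tendsto (fun t : ℝ => √E * |t - b|) (𝓝 b) (𝓝 (√E * |b - b|)) :=
      (Continuous.tendsto (by fun_prop) b)
    exact e1.eventually_lt_const (by simpa using hℓ0)
  rw [mem_map]
  filter_upwards [hev, self_mem_nhdsWithin] with t ht htI
  obtain ⟨h1, h2⟩ := hcurve (hτI k) htI
  have h3 : √E * |t - τ k| ≤ ℓ := by
    have : |t - τ k| ≤ |t - b| + |τ k - b| := by
      rw [abs_sub_comm (τ k) b]; exact abs_sub_le t b (τ k)
    nlinarith [Real.sqrt_nonneg E]
  have h4 := h1.mem_chart_of_length_le (c := y) (r := m * B * ℓ) hR hB0.le hℓ0.le hB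
    (h2.trans (ENNReal.ofReal_le_ofReal h3)) (left_mem_Icc.2 zero_le_one)
    (by simpa using hx.1) (by simpa using hx.2) (by linarith [min_le_left R ρ'])
    1 (right_mem_Icc.2 zero_le_one)
  simp only [mul_one, mul_zero, add_zero, add_sub_cancel] at h4
  refine hρ' _ h4.1 ?_
  linarith [dist_triangle (extChartAt (𝓡 n) y (ξ t).1) (extChartAt (𝓡 n) y (ξ (τ k)).1)
    (extChartAt (𝓡 n) y y), h4.2, hx.2, min_le_right R ρ']

/-- Conservation of energy makes the inequality for the momentum linear with a constant coefficient,
so the momentum stays bounded near b. The coordinates are then Lipschitz, hence Cauchy. -/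
theorem exists_tendsto_cotangentCoord {ξ : ℝ → CotangentBundle n M} {I : Set ℝ}
    (hI : Convex ℝ I) (h : ∀ t ∈ I, S.IsHamAt ξ t) {b : ℝ} (hb : b ∈ closure I) {y : M}
    (hy : Tendsto (fun t => (ξ t).1) (𝓝[I] b) (𝓝 y)) :
    ∃ z₀ : PhaseSpace n, z₀.1 = extChartAt (𝓡 n) y y ∧
      Tendsto (fun t => cotangentCoord y (ξ t)) (𝓝[I] b) (𝓝 z₀) := by
  have hne : (𝓝[I] b).NeBot := mem_closure_iff_nhdsWithin_neBot.1 hb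
  have hyc := mem_extChartAt_source (I := 𝓡 n) y
  have hq : Tendsto (fun t => extChartAt (𝓡 n) y (ξ t).1) (𝓝[I] b) (𝓝 (extChartAt (𝓡 n) y y)) :=
    (continuousAt_extChartAt y).tendsto.comp hy
  suffices hex : ∃ z₀, Tendsto (fun t => cotangentCoord y (ξ t)) (𝓝[I] b) (𝓝 z₀) by
    obtain ⟨z₀, hz₀⟩ := hex
    exact ⟨z₀, tendsto_nhds_unique ((continuous_fst.tendsto z₀).comp hz₀) hq, hz₀⟩
  obtain ⟨R, hR0, hR⟩ := exists_closedBall_subset_target y y hyc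
  obtain ⟨B, hB0, hB, hB'⟩ := S.exists_bound_frameCoord (isCompact_closedBall _ R) hR
  obtain ⟨t₁, ht₁⟩ := closure_nonempty_iff.1 ⟨b, hb⟩
  set E : ℝ := 2 * S.hamiltonian (ξ t₁) with hE
  have hev : ∀ᶠ t in 𝓝[I] b, (ξ t).1 ∈ (extChartAt (𝓡 n) y).source ∧
      extChartAt (𝓡 n) y (ξ t).1 ∈ Metric.closedBall (extChartAt (𝓡 n) y y) R :=
    (hy.eventually ((isOpen_extChartAt_source y).mem_nhds hyc)).and
      (hq.eventually (Metric.closedBall_mem_nhds _ hR0))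
  obtain ⟨δ₁, hδ₁, hball⟩ := Metric.mem_nhdsWithin_iff.1 hev
  -- Subintervals of the ball of radius δ have length at most 2δ, short enough for
  -- `norm_le_two_mul_of_norm_deriv_le`.
  obtain ⟨δ, hδ0, hδ1, hδ2⟩ : ∃ δ > 0, δ ≤ δ₁ ∧ 2 * δ * (m * √E * B) ≤ 1 / 2 := by
    refine ⟨min δ₁ (1 / (4 * (m * √E * B + 1))), by positivity, min_le_left _ _, ?_⟩
    have h0 : 0 ≤ m * √E * B := by positivity
    calc _ ≤ 2 * (1 / (4 * (m * √E * B + 1))) * (m * √E * B) := by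
          gcongr; exact min_le_right _ _
      _ ≤ _ := by
          rw [← sub_nonneg]
          have : 1 / 2 - 2 * (1 / (4 * (m * √E * B + 1))) * (m * √E * B) =
            1 / (2 * (m * √E * B + 1)) := by field_simp; ring
          rw [this]; positivity
  set J : Set ℝ := I ∩ Metric.ball b δ with hJ
  have hJc : Convex ℝ J := hI.inter (convex_ball b δ)
  have hJev : ∀ t ∈ J, (ξ t).1 ∈ (extChartAt (𝓡 n) y).source ∧
      extChartAt (𝓡 n) y (ξ t).1 ∈ Metric.closedBall (extChartAt (𝓡 n) y y) R := fun t ht =>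
    hball ⟨Metric.ball_subset_ball hδ1 ht.2, ht.1⟩
  have hJn : J ∈ 𝓝[I] b := inter_mem self_mem_nhdsWithin
    (mem_nhdsWithin_of_mem_nhds (Metric.ball_mem_nhds b hδ0))
  obtain ⟨t₂, ht₂⟩ : J.Nonempty := nonempty_of_mem hJn
  have hz : ∀ t ∈ J, HasDerivAt (fun s => cotangentCoord y (ξ s))
      (S.hamField y (cotangentCoord y (ξ t))) t := fun t ht => (h t ht.1).2 y (hJev t ht).1
  have hz2 : ∀ t ∈ J, HasDerivAt (fun s => (cotangentCoord y (ξ s)).2)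
      (S.hamField y (cotangentCoord y (ξ t))).2 t := fun t ht => (hz t ht).snd
  have hp : ∀ t ∈ J, ‖(cotangentCoord y (ξ t)).2‖ ≤ 2 * ‖(cotangentCoord y (ξ t₂)).2‖ := by
    intro t ht
    have hsub : Icc (min t₂ t) (max t₂ t) ⊆ J := hJc.ordConnected.uIcc_subset ht₂ ht
    have hlen : max t₂ t - min t₂ t ≤ 2 * δ := by
      have h1 := ht₂.2
      have h2 := ht.2
      rw [Real.ball_eq_Ioo] at h1 h2
      rcases le_total t₂ t with h | h
      · rw [max_eq_right h, min_eq_left h]; linarith [h1.1, h2.2]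
      · rw [max_eq_left h, min_eq_right h]; linarith [h1.2, h2.1]
    refine norm_le_two_mul_of_norm_deriv_le (L := m * √E * B)
      (fun s hs => (hz2 s (hsub hs)).hasDerivWithinAt) (fun s hs => ?_) (by positivity)
      ((mul_le_mul_of_nonneg_right hlen (by positivity)).trans hδ2) left_mem_uIcc right_mem_uIcc
    have hsJ := hsub hs
    refine S.norm_hamField_snd_le (hB' _ (hJev s hsJ).2) ?_
    rw [S.hamCoord_cotangentCoord (hJev s hsJ).1, hamiltonian_eq_of_isHamAt hI h hsJ.1 ht₁]
  obtain ⟨K, hK⟩ : ∃ K : Set (PhaseSpace n), K = Metric.closedBall (extChartAt (𝓡 n) y y) R ×ˢ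
    Metric.closedBall 0 (2 * ‖(cotangentCoord y (ξ t₂)).2‖) := ⟨_, rfl⟩
  have hKc : IsCompact K := hK ▸ (isCompact_closedBall _ _).prod (isCompact_closedBall _ _)
  have hKt : K ⊆ (extChartAt (𝓡 n) y).target ×ˢ univ := hK ▸ prod_mono hR (subset_univ _)
  have hzK : ∀ t ∈ J, cotangentCoord y (ξ t) ∈ K := fun t ht => by
    rw [hK]
    refine ⟨(hJev t ht).2, ?_⟩
    rw [Metric.mem_closedBall, dist_zero_right]
    exact hp t ht
  obtain ⟨D, hD⟩ := hKc.exists_bound_of_continuousOn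
    ((S.contDiffOn_hamField y).continuousOn.mono hKt)
  have hL : LipschitzOnWith D.toNNReal (fun s => cotangentCoord y (ξ s)) J :=
    hJc.lipschitzOnWith_of_nnnorm_hasDerivWithin_le
      (fun t ht => (hz t ht).hasDerivWithinAt) fun t ht => by
        rw [← NNReal.coe_le_coe, coe_nnnorm]
        exact (hD _ (hzK t ht)).trans (Real.le_coe_toNNReal D)
  have hcauchy : Cauchy (𝓝[I] b) := cauchy_nhds.mono nhdsWithin_le_nhds
  exact cauchy_map_iff_exists_tendsto.1
    (hcauchy.map_of_le hL.uniformContinuousOn (le_principal_iff.2 hJn))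

/-- Local existence of Hamiltonian curves. -/
theorem exists_isHamAt_local (S : SubRiemannianStructure n m M) (c : M) {z₀ : PhaseSpace n}
    (hz₀ : z₀.1 ∈ (extChartAt (𝓡 n) c).target) (b : ℝ) :
    ∃ ζ : ℝ → PhaseSpace n, ζ b = z₀ ∧ ∃ ε > 0, ∀ t, |t - b| < ε →
      (ζ t).1 ∈ (extChartAt (𝓡 n) c).target ∧ HasDerivAt ζ (S.hamField c (ζ t)) t ∧
        S.IsHamAt (fun s => cotangentCoordSymm c (ζ s)) t := by
  have hz₀' : z₀ ∈ (extChartAt (𝓡 n) c).target ×ˢ (univ : Set (Eucl n →L[ℝ] ℝ)) :=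
    ⟨hz₀, mem_univ _⟩
  obtain ⟨ζ, hζb, ε, hε, hζ⟩ := ((S.contDiffOn_hamField c).contDiffAt
    ((isOpen_phaseDomain c).mem_nhds hz₀')).exists_forall_mem_closedBall_exists_eq_forall_mem_Ioo_hasDerivAt₀ b
  have hcont : ContinuousAt ζ b := (hζ b ⟨by linarith, by linarith⟩).continuousAt
  have hev : ∀ᶠ t in 𝓝 b, (ζ t).1 ∈ (extChartAt (𝓡 n) c).target :=
    hcont.fst.eventually ((isOpen_extChartAt_target c).mem_nhds (by simpa only [hζb] using hz₀))
  obtain ⟨δ, hδ, hball⟩ := Metric.mem_nhds_iff.1 hev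
  refine ⟨ζ, hζb, min ε δ, lt_min hε hδ, fun t ht => ?_⟩
  have ht1 : ∀ s, |s - b| < min ε δ → (ζ s).1 ∈ (extChartAt (𝓡 n) c).target := fun s hs =>
    hball (Metric.mem_ball.2 (hs.trans_le (min_le_right _ _)))
  have ht2 : HasDerivAt ζ (S.hamField c (ζ t)) t := by
    have := abs_lt.1 (ht.trans_le (min_le_left _ _))
    exact hζ t ⟨by linarith [this.1], by linarith [this.2]⟩
  have hbase : ContinuousAt (fun s => (cotangentCoordSymm c (ζ s)).1) t :=
    ContinuousAt.comp (g := (extChartAt (𝓡 n) c).symm) (f := fun s => (ζ s).1)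
      ((continuousOn_extChartAt_symm c).continuousAt
        ((isOpen_extChartAt_target c).mem_nhds (ht1 t ht))) ht2.continuousAt.fst
  refine ⟨ht1 t ht, ht2, hbase, fun d hd => ?_⟩
  refine S.hasDerivAt_cotangentCoord_change hbase ((extChartAt (𝓡 n) c).map_target (ht1 t ht)) hd ?_
  rw [cotangentCoord_cotangentCoordSymm (ht1 t ht)]
  refine ht2.congr_of_eventuallyEq ?_
  have : ∀ᶠ s in 𝓝 t, |s - b| < min ε δ :=
    (Continuous.tendsto (by fun_prop : Continuous fun s : ℝ => |s - b|) t).eventually_lt_const ht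
  filter_upwards [this] with s hs
  exact cotangentCoord_cotangentCoordSymm (ht1 s hs)

end SubRiemannianStructure

end Completeness

/-! ### Extension of Hamiltonian curves to all times. -/

section GlobalFlow

variable {n m : ℕ} {M : Type*} [TopologicalSpace M] [ChartedSpace (Eucl n) M]
  [IsManifold (𝓡 n) ∞ M] {S : SubRiemannianStructure n m M}

namespace SubRiemannianStructure

/-- A Hamiltonian curve that converges at an extremity of its interval of definition can be
extended. -/
theorem exists_extension_of_isHamAt {ξ : ℝ → CotangentBundle n M} {I : Set ℝ} (hIo : IsOpen I)
    (hI : Convex ℝ I) (h : ∀ t ∈ I, S.IsHamAt ξ t) {b : ℝ} (hb : b ∈ closure I) (hbI : b ∉ I)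
    {y : M} (hy : Tendsto (fun t => (ξ t).1) (𝓝[I] b) (𝓝 y)) :
    ∃ (I' : Set ℝ) (g : ℝ → CotangentBundle n M), IsOpen I' ∧ Convex ℝ I' ∧ I ⊆ I' ∧ b ∈ I' ∧
      EqOn ξ g I ∧ ∀ t ∈ I', S.IsHamAt g t := by
  classical
  have hyc := mem_extChartAt_source (I := 𝓡 n) y
  obtain ⟨z₀, hz₀, hz₀t⟩ := exists_tendsto_cotangentCoord hI h hb hy
  have hz₀m : z₀.1 ∈ (extChartAt (𝓡 n) y).target := hz₀ ▸ (extChartAt (𝓡 n) y).map_source hyc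
  obtain ⟨ζ, hζb, ε₁, hε₁, hζ⟩ := S.exists_isHamAt_local y hz₀m b
  have hev : ∀ᶠ t in 𝓝[I] b, (ξ t).1 ∈ (extChartAt (𝓡 n) y).source :=
    hy.eventually ((isOpen_extChartAt_source y).mem_nhds hyc)
  obtain ⟨δ, hδ, hball⟩ := Metric.mem_nhdsWithin_iff.1 hev
  obtain ⟨t₁, ht₁I, ht₁⟩ := Metric.mem_closure_iff.1 hb δ hδ
  rw [dist_comm] at ht₁
  have ht₁b : 0 < |t₁ - b| := abs_pos.2 (sub_ne_zero.2 fun he => hbI (he ▸ ht₁I))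
  -- Within |t₁ − b| of b, the part of I is the segment between t₁ and b and everything else lies at
  -- b or beyond, so the gluing happens only at b.
  set ε := min ε₁ |t₁ - b| with hε
  have hε0 : 0 < ε := lt_min hε₁ ht₁b
  set g : ℝ → CotangentBundle n M := fun t => if t ∈ I then ξ t else cotangentCoordSymm y (ζ t)
    with hg
  have hgI : ∀ t ∈ I, g t = ξ t := fun t ht => if_pos ht
  have hgn : ∀ t ∉ I, g t = cotangentCoordSymm y (ζ t) := fun t ht => if_neg ht
  have hζ' : ∀ t, |t - b| < ε → (ζ t).1 ∈ (extChartAt (𝓡 n) y).target ∧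
      HasDerivAt ζ (S.hamField y (ζ t)) t ∧ S.IsHamAt (fun s => cotangentCoordSymm y (ζ s)) t :=
    fun t ht => hζ t (ht.trans_le (min_le_left _ _))
  have hbε : |b - b| < ε := by simpa using hε0
  have hball' : IsOpen (Metric.ball b ε) := Metric.isOpen_ball
  refine ⟨I ∪ Metric.ball b ε, g, hIo.union hball', ?_, subset_union_left,
    Or.inr (Metric.mem_ball_self hε0), fun t ht => (hgI t ht).symm, ?_⟩
  · obtain ⟨s, hsI, hs⟩ := Metric.mem_closure_iff.1 hb ε hε0
    rw [Real.convex_iff_isPreconnected]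
    exact (hI.isPreconnected).union s hsI (by rwa [Metric.mem_ball, dist_comm])
      (convex_ball b ε).isPreconnected
  intro t ht
  by_cases htI : t ∈ I
  · exact (h t htI).congr (by filter_upwards [hIo.mem_nhds htI] with s hs using (hgI s hs).symm)
  have htb : |t - b| < ε := ht.resolve_left htI
  rcases ne_or_eq t b with hne | rfl
  · have htc := notMem_closure_of_dist_lt hIo hI ht₁I hb hbI (htb.trans_le (min_le_right _ _)) htI hne
    refine (hζ' t htb).2.2.congr ?_
    filter_upwards [isClosed_closure.isOpen_compl.mem_nhds htc] with s hs
    exact (hgn s fun hsI => hs (subset_closure hsI)).symm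
  · have hgb : (g t).1 = y := by
      rw [hgn t htI, hζb]
      change (extChartAt (𝓡 n) y).symm z₀.1 = y
      rw [hz₀, extChartAt_to_inv]
    have hbase : ContinuousAt (fun s => (g s).1) t := by
      have h1 : Tendsto (fun s => (g s).1) (𝓝[I] t) (𝓝 y) :=
        hy.congr' (by filter_upwards [self_mem_nhdsWithin] with s hs using by rw [hgI s hs])
      have h2 : Tendsto (fun s => (g s).1) (𝓝[Iᶜ] t) (𝓝 y) := by
        have h3 : Tendsto (fun s => (cotangentCoordSymm y (ζ s)).1) (𝓝 t)
            (𝓝 (cotangentCoordSymm y (ζ t)).1) := (hζ' t htb).2.2.1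
        rw [← hgn t htI, hgb] at h3
        refine (h3.mono_left nhdsWithin_le_nhds).congr' ?_
        filter_upwards [self_mem_nhdsWithin] with s hs using by rw [hgn s hs]
      rw [ContinuousAt, hgb, ← nhdsWithin_univ, ← union_compl_self I, nhdsWithin_union]
      exact h1.sup h2
    refine ⟨hbase, fun d hd => S.hasDerivAt_cotangentCoord_change (c := y) hbase
      (by rw [hgb]; exact hyc) hd ?_⟩
    have hZb : cotangentCoord y (g t) = z₀ := by
      rw [hgn t htI, hζb, cotangentCoord_cotangentCoordSymm hz₀m]
    rw [hZb]
    set J : Set ℝ := Ioo (min t₁ t) (max t₁ t) with hJ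
    have hJI : J ⊆ I := Ioo_min_max_subset hIo hI ht₁I hb
    have hJδ : ∀ s ∈ Icc (min t₁ t) (max t₁ t), dist s t < δ := fun s hs =>
      (Real.dist_right_le_of_mem_uIcc (x := t₁) hs).trans_lt ht₁
    have hd1 : ∀ s ∈ I, dist s t < δ → HasDerivAt (fun s => cotangentCoord y (g s))
        (S.hamField y (cotangentCoord y (ξ s))) s := fun s hs hsδ =>
      ((h s hs).2 y (hball ⟨hsδ, hs⟩)).congr_of_eventuallyEq
        (by filter_upwards [hIo.mem_nhds hs] with r hr using by rw [hgI r hr])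
    have hlim : Tendsto (fun s => cotangentCoord y (g s)) (𝓝[J] t) (𝓝 z₀) := by
      refine (hz₀t.mono_left (nhdsWithin_mono t hJI)).congr' ?_
      filter_upwards [self_mem_nhdsWithin] with s hs using by rw [hgI s (hJI hs)]
    have hF : ContinuousAt (S.hamField y) z₀ := by
      have hm : z₀ ∈ (extChartAt (𝓡 n) y).target ×ˢ (univ : Set (Eucl n →L[ℝ] ℝ)) :=
        ⟨hz₀m, mem_univ _⟩
      exact (S.contDiffOn_hamField y).continuousOn.continuousAt ((isOpen_phaseDomain y).mem_nhds hm)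
    -- At the gluing point the old curve has a one-sided derivative, the limit of its derivatives;
    -- on the other side the local solution has the same one. The two sides cover a neighbourhood.
    have hw1 : HasDerivWithinAt (fun s => cotangentCoord y (g s)) (S.hamField y z₀) (closure J) t := by
      refine hasDerivWithinAt_closure_of_tendsto
        (Z' := fun s => S.hamField y (cotangentCoord y (g s))) isOpen_Ioo (convex_Ioo _ _)
        (fun s hs => ?_) (fun s hs => ?_) (hF.tendsto.comp hlim)
      · have := hd1 s (hJI hs) (hJδ s (Ioo_subset_Icc_self hs))
        rwa [← hgI s (hJI hs)] at this
      · have hsJ : s ∈ Icc (min t₁ t) (max t₁ t) :=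
          closure_minimal Ioo_subset_Icc_self isClosed_Icc hs
        rcases eq_or_ne s t with rfl | hst
        · rw [ContinuousWithinAt, hZb]
          exact hlim
        · have hsI : s ∈ I := by
            rcases eq_or_ne s t₁ with rfl | hst₁
            · exact ht₁I
            · refine hJI ⟨lt_of_le_of_ne hsJ.1 ?_, lt_of_le_of_ne hsJ.2 ?_⟩
              · rcases min_choice t₁ t with hm | hm <;> rw [hm]
                exacts [hst₁.symm, hst.symm]
              · rcases max_choice t₁ t with hm | hm <;> rw [hm]
                exacts [hst₁, hst]
          exact (hd1 s hsI (hJδ s hsJ)).continuousAt.continuousWithinAt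
    have hw2 : HasDerivWithinAt (fun s => cotangentCoord y (g s)) (S.hamField y z₀)
        (Iᶜ ∩ Metric.ball t ε) t := by
      have h1 := (hζ' t htb).2.1.hasDerivWithinAt (s := Iᶜ ∩ Metric.ball t ε)
      rw [hζb] at h1
      refine h1.congr (fun s hs => ?_) ?_
      · rw [hgn s hs.1, cotangentCoord_cotangentCoordSymm (hζ' s hs.2).1]
      · rw [hZb, hζb]
    refine (hw1.union hw2).hasDerivAt ?_
    filter_upwards [Metric.ball_mem_nhds t hε0] with s hs
    by_cases hsI : s ∈ I
    · exact Or.inl (subset_closure (mem_Ioo_min_max_of_dist_lt hIo hI ht₁I hbI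
        (lt_of_lt_of_le hs (min_le_right _ _)) hsI))
    · exact Or.inr ⟨hsI, hs⟩

/-- In a complete sub-Riemannian manifold, Hamiltonian curves are defined for all times. -/
theorem exists_forall_isHamAt [T2Space M] (hS : S.IsCompleteSR) (ξ₀ : CotangentBundle n M) :
    ∃ ξ : ℝ → CotangentBundle n M, ξ 0 = ξ₀ ∧ ∀ t, S.IsHamAt ξ t := by
  classical
  let Q := {A : Set ℝ × (ℝ → CotangentBundle n M) // IsOpen A.1 ∧ Convex ℝ A.1 ∧ 0 ∈ A.1 ∧
    A.2 0 = ξ₀ ∧ ∀ t ∈ A.1, S.IsHamAt A.2 t}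
  -- Agreement is part of the order, so the union of a chain is well defined without uniqueness of
  -- integral curves.
  let r : Q → Q → Prop := fun A B => A.1.1 ⊆ B.1.1 ∧ EqOn A.1.2 B.1.2 A.1.1
  have hloc : Nonempty Q := by
    have hx := mem_extChartAt_source (I := 𝓡 n) ξ₀.1
    obtain ⟨ζ, hζ0, ε, hε, hζ⟩ := S.exists_isHamAt_local ξ₀.1 (cotangentCoord_fst_mem hx) 0
    refine ⟨⟨(Metric.ball 0 ε, fun s => cotangentCoordSymm ξ₀.1 (ζ s)), Metric.isOpen_ball,
      convex_ball 0 ε, Metric.mem_ball_self hε, ?_, fun t ht => (hζ t ht).2.2⟩⟩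
    change cotangentCoordSymm ξ₀.1 (ζ 0) = ξ₀
    rw [hζ0, cotangentCoordSymm_cotangentCoord hx]
  obtain ⟨A, hA⟩ := exists_maximal_of_chains_bounded (r := r) (fun c hc => by
    rcases c.eq_empty_or_nonempty with rfl | ⟨A₀, hA₀⟩
    · exact ⟨hloc.some, by simp⟩
    have hcomp : ∀ A ∈ c, ∀ B ∈ c, ∀ t, t ∈ A.1.1 → t ∈ B.1.1 → A.1.2 t = B.1.2 t := by
      intro A hA B hB t htA htB
      rcases eq_or_ne A B with rfl | hne
      · rfl
      rcases hc hA hB hne with h | h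
      · exact h.2 htA
      · exact (h.2 htB).symm
    let f : ℝ → CotangentBundle n M := fun t =>
      if h : ∃ A ∈ c, t ∈ A.1.1 then h.choose.1.2 t else ξ₀
    have hf : ∀ A ∈ c, ∀ t ∈ A.1.1, f t = A.1.2 t := by
      intro A hA t ht
      have hex : ∃ A ∈ c, t ∈ A.1.1 := ⟨A, hA, ht⟩
      simp only [f, dif_pos hex]
      exact hcomp _ hex.choose_spec.1 _ hA t hex.choose_spec.2 ht
    refine ⟨⟨(⋃ A ∈ c, A.1.1, f), isOpen_biUnion fun A _ => A.2.1, ?_,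
      mem_biUnion hA₀ A₀.2.2.2.1, (hf A₀ hA₀ 0 A₀.2.2.2.1).trans A₀.2.2.2.2.1, ?_⟩, ?_⟩
    · rw [Real.convex_iff_isPreconnected, ← sUnion_image]
      refine isPreconnected_sUnion 0 _ ?_ ?_
      · rintro _ ⟨A, -, rfl⟩; exact A.2.2.2.1
      · rintro _ ⟨A, -, rfl⟩; exact A.2.2.1.isPreconnected
    · intro t ht
      obtain ⟨A, hA, htA⟩ := mem_iUnion₂.1 ht
      refine (A.2.2.2.2.2 t htA).congr ?_
      filter_upwards [A.2.1.mem_nhds htA] with s hs using (hf A hA s hs).symm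
    · exact fun A hA => ⟨subset_biUnion_of_mem (u := fun A : Q => A.1.1) hA,
        fun t ht => (hf A hA t ht).symm⟩)
    (fun h1 h2 => ⟨h1.1.trans h2.1, fun t ht => (h1.2 ht).trans (h2.2 (h1.1 ht))⟩)
  obtain ⟨⟨I, ξ⟩, hIo, hI, h0, hξ0, hξ⟩ := A
  -- A missing endpoint would allow an extension, against maximality; so the domain is open and
  -- closed in ℝ.
  have hcl : closure I ⊆ I := by
    intro b hb
    by_contra hbI
    obtain ⟨y, hy⟩ := exists_tendsto_fst_of_isHamAt hS hI hξ hb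
    obtain ⟨I', g, h1, h2, h3, h4, h5, h6⟩ := exists_extension_of_isHamAt hIo hI hξ hb hbI hy
    exact hbI ((hA ⟨(I', g), h1, h2, h3 h0, (h5 h0).symm.trans hξ0, h6⟩ ⟨h3, h5⟩).1 h4)
  have huniv : I = univ := IsClopen.eq_univ ⟨isClosed_of_closure_subset hcl, hIo⟩ ⟨0, h0⟩
  exact ⟨ξ, hξ0, fun t => hξ t (by rw [huniv]; exact mem_univ t)⟩

end SubRiemannianStructure

end GlobalFlow

end SubRiemannian

/-! ### The main theorem. -/

open SubRiemannian
theorem mainTheorem5 {n m : ℕ} (hn : 2 ≤ n) {M : Type*} [TopologicalSpace M]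
    [ChartedSpace (EuclideanSpace ℝ (Fin n)) M] [IsManifold (𝓡 n) ∞ M]
    [T2Space M] [SecondCountableTopology M]
    (S : SubRiemannianStructure n m M) (hS : S.IsCompleteSR) :
    -- the Hamiltonian vector field is complete
    (∃ Φ, IsHamiltonianFlow S.hamiltonian Φ) ∧
    ∀ Φ : ℝ → CotangentBundle n M → CotangentBundle n M, IsHamiltonianFlow S.hamiltonian Φ →
      -- compact sets of initial covectors at a point
      (∀ (x : M) (Λ : Set (Cotangent n x)), IsCompact Λ →
        ∃ ε : ℝ, 0 < ε ∧ ∀ p ∈ Λ,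
          S.IsUniqueLengthMinimizer (fun s => (Φ s ⟨x, p⟩).1) (-ε) ε) ∧
      -- the family `γ_α` associated with a normal path `γ` and its lift `s ↦ Φ s ξ`
      (∀ ξ : CotangentBundle n M,
        ∀ t ∈ Ioo (0 : ℝ) 1, ∀ A₀ : Set (Cotangent n (Φ t ξ).1), IsCompact A₀ →
          A₀ ⊆ S.abnormalMultipliers (fun s => (Φ s ξ).1) t ∪ {0} →
            ∃ ε : ℝ, 0 < ε ∧ 0 ≤ t - ε ∧ t + ε ≤ 1 ∧ ∀ α ∈ A₀,
              S.IsUniqueLengthMinimizer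
                (fun s => (Φ (s - t) ⟨(Φ t ξ).1, (Φ t ξ).2 + α⟩).1) (t - ε) (t + ε)) := by
  refine ⟨?_, fun Φ hΦ => ?_⟩
  · choose Φ hΦ0 hΦ using fun ξ₀ => SubRiemannianStructure.exists_forall_isHamAt hS ξ₀
    exact ⟨fun t ξ => Φ ξ t, fun ξ => ⟨hΦ0 ξ, S.isHamiltonianCurve_iff_isHamAt.2 (hΦ ξ)⟩⟩
  have hham : ∀ ξ t, S.IsHamAt (fun s => Φ s ξ) t := fun ξ =>
    S.isHamiltonianCurve_iff_isHamAt.1 (hΦ ξ).2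
  refine ⟨fun x Λ hΛ => ?_, fun ξ t ht A₀ hA₀ _ => ?_⟩
  · obtain ⟨ε, hε, h⟩ := S.exists_isUniqueLengthMinimizer x hΛ
    refine ⟨ε, hε, fun p hp => ?_⟩
    have := h ε hε le_rfl (fun s => Φ s ⟨x, p⟩) 0 (hham _) ⟨p, hp, (hΦ _).1⟩
    rwa [zero_sub, zero_add] at this
  -- At time t the lifts of the curves γ_α form the translate λ(t) + A₀ in a single cotangent space.
  · have hΛ : IsCompact ((fun α => (Φ t ξ).2 + α) '' A₀) := hA₀.image (continuous_const_add _)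
    obtain ⟨ε₀, hε₀, h⟩ := S.exists_isUniqueLengthMinimizer (Φ t ξ).1 hΛ
    have hpos : 0 < min ε₀ (min t (1 - t)) := lt_min hε₀ (lt_min ht.1 (sub_pos.2 ht.2))
    have h1 : min ε₀ (min t (1 - t)) ≤ t := (min_le_right _ _).trans (min_le_left _ _)
    have h2 : min ε₀ (min t (1 - t)) ≤ 1 - t := (min_le_right _ _).trans (min_le_right _ _)
    refine ⟨min ε₀ (min t (1 - t)), hpos, by linarith, by linarith, fun α hα => ?_⟩
    refine h _ hpos (min_le_left _ _) (fun s => Φ (s - t) ⟨(Φ t ξ).1, (Φ t ξ).2 + α⟩) t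
      (fun s => (hham _ (s - t)).comp_sub_const t) ⟨_, mem_image_of_mem _ hα, ?_⟩
    simp only [sub_self, (hΦ _).1]
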